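/- A closed Riemann surface is a compact connected one-dimensional complex manifold. A singular Riemann surface is the quotient space of a disjoint union $R_1\sqcup\dots\sqcup R_n$ ($n\ge 1$) of closed Riemann surfaces obtained by identifying, for each $k=1,\dots,m$, all points of $C_k$ to one point, where $C_1,\dots,C_m$ are pairwise disjoint nonempty finite subsets of $R_1\sqcup\dots\sqcup R_n$ (singletons are allowed); the points of the quotient coming from $C_1,\dots,C_m$ are its singularities. Proposition 2.1. Let $S_0,S_1,S_2$ be closed Riemann surfaces, let $\beta_1:S_1\to S_0$ and $\beta_2:S_2\to S_0$ be non-constant holomorphic maps, and let $$F=S_1\times_{(\beta_1,\beta_2)}S_2=\{(z_1,z_2)\in S_1\times S_2:\ \beta_1(z_1)=\beta_2(z_2)\}$$ be their fiber product, with the subspace topology. For $z_j\in S_j$ let $\operatorname{ord}_{\beta_j}(z_j)$ be the local order of $\beta_j$ at $z_j$, i.e. the integer $n_j\ge 1$ such that $\beta_j$ is $t\mapsto t^{n_j}$ in suitable local coordinates centered at $z_j$ and $\beta_j(z_j)$. Then: 1. $F$ is a singular Riemann surface: there are a singular Riemann surface $X$, with components $R_1,\dots,R_n$ and gluing map $q:R_1\sqcup\dots\sqcup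 R_n\to X$, and a homeomorphism $\Phi:X\to F$ such that, for $j=1,2$ and every $i$, the map $\pi_j\circ\Phi\circ q|_{R_i}:R_i\to S_j$ is holomorphic, where $\pi_j(z_1,z_2)=z_j$. Moreover $\Phi$ maps the set of singularities of $X$ onto the set of singular points of $F$, i.e. of those $(z_1,z_2)\in F$ with $\operatorname{ord}_{\beta_1}(z_1)\ge 2$ and $\operatorname{ord}_{\beta_2}(z_2)\ge 2$, and for every $(z_1,z_2)\in F$ exactly $\gcd(\operatorname{ord}_{\beta_1}(z_1),\operatorname{ord}_{\beta_2}(z_2))$ points of $R_1\sqcup\dots\sqcup R_n$ are mapped to $(z_1,z_2)$ by $\Phi\circ q$. 2. Let $(z_1,z_2)\in F$ and $d=\gcd(\operatorname{ord}_{\beta_1}(z_1),\operatorname{ord}_{\beta_2}(z_2))$. Then $(z_1,z_2)$ has an open neighborhood in $F$ that is homeomorphic to a union of $d$ cones (that is, $d$ copies of the open unit disc, each with its center as vertex) glued at their common vertex, by a homeomorphism that sends $(z_1,z_2)$ to this vertex. -/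

import Mathlib

open scoped Manifold ContDiff

universe u v w

/-- A closed Riemann surface: a compact connected Hausdorff complex manifold of dimension one.
(Second countability is automatic, by compactness.) -/
structure ClosedRiemannSurface : Type (u + 1) where
  carrier : Type u
  [topologicalSpace : TopologicalSpace carrier]
  [chartedSpace : ChartedSpace ℂ carrier]
  [isManifold : IsManifold 𝓘(ℂ) ω carrier]
  [t2Space : T2Space carrier]
  [compactSpace : CompactSpace carrier]
  [connectedSpace : ConnectedSpace carrier]

namespace ClosedRiemannSurface

instance : CoeSort ClosedRiemannSurface.{u} (Type u) := ⟨carrier⟩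

attribute [instance] topologicalSpace chartedSpace isManifold t2Space compactSpace connectedSpace

end ClosedRiemannSurface

/-- A holomorphic map between complex manifolds of dimension one. -/
def IsHolomorphicMap {X : Type u} {Y : Type v} [TopologicalSpace X] [ChartedSpace ℂ X]
    [TopologicalSpace Y] [ChartedSpace ℂ Y] (f : X → Y) : Prop :=
  MDifferentiable 𝓘(ℂ) 𝓘(ℂ) f

/-- The local order of `f` at `z`: the order of vanishing, at the coordinate of `z`, of
`f - f(z)` read in local charts around `z` and `f z`. It is the positive integer `n` such that `f`
is `t ↦ t ^ n` in suitable local coordinates, when `f` is holomorphic and not locally constant. -/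
noncomputable def localOrder {X : Type u} {Y : Type v} [TopologicalSpace X] [ChartedSpace ℂ X]
    [TopologicalSpace Y] [ChartedSpace ℂ Y] (f : X → Y) (z : X) : ℕ :=
  analyticOrderNatAt
    (fun t : ℂ => chartAt ℂ (f z) (f ((chartAt ℂ z).symm t)) - chartAt ℂ (f z) (f z))
    (chartAt ℂ z z)

/-- Finitely many closed Riemann surfaces (at least one), with finitely many pairwise disjoint
nonempty finite subsets of their disjoint union; each of these subsets is to be identified to a
point. -/
structure SingularRiemannSurface : Type (u + 1) where
  numComponents : ℕ
  numComponents_pos : 0 < numComponents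
  component : Fin numComponents → ClosedRiemannSurface.{u}
  numClasses : ℕ
  gluedClass : Fin numClasses → Set (Σ i, component i)
  gluedClass_finite : ∀ k, (gluedClass k).Finite
  gluedClass_nonempty : ∀ k, (gluedClass k).Nonempty
  gluedClass_disjoint : Pairwise fun k l => Disjoint (gluedClass k) (gluedClass l)

namespace SingularRiemannSurface

/-- The space obtained from the disjoint union of the components by identifying any two points of
a same glued class; it carries the quotient topology. -/
abbrev Space (X : SingularRiemannSurface.{u}) : Type u :=
  Quot fun x y : Σ i, X.component i => ∃ k, x ∈ X.gluedClass k ∧ y ∈ X.gluedClass k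

/-- The gluing map. -/
def glue (X : SingularRiemannSurface.{u}) (x : Σ i, X.component i) : X.Space :=
  Quot.mk _ x

/-- The singularities: the points of the quotient that come from the glued classes. -/
def singularities (X : SingularRiemannSurface.{u}) : Set X.Space :=
  ⋃ k, X.glue '' X.gluedClass k

end SingularRiemannSurface

/-- The singular points of the fiber product: both coordinates are critical points, i.e. points of
local order at least two. The fiber product itself is `Function.Pullback f g`, the subspace
`{p : X × Y // f p.1 = g p.2}` of the product. -/
def fiberProductSingularPoints {X : Type u} {Y : Type v} {Z : Type w}
    [TopologicalSpace X] [ChartedSpace ℂ X] [TopologicalSpace Y] [ChartedSpace ℂ Y]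
    [TopologicalSpace Z] [ChartedSpace ℂ Z] (f : X → Z) (g : Y → Z) :
    Set (Function.Pullback f g) :=
  {p | 2 ≤ localOrder f p.1.1 ∧ 2 ≤ localOrder g p.1.2}

/-- The union of `d` (open) cones over the circle, i.e. `d` open unit discs with vertex at the
center, glued at their common vertex, with the quotient topology. -/
abbrev ConeBouquet (d : ℕ) : Type :=
  Quot fun x y : Fin d × Metric.ball (0 : ℂ) 1 => (x.2 : ℂ) = 0 ∧ (y.2 : ℂ) = 0

/-- `b` is the common vertex of the cones. -/
def ConeBouquet.IsVertex {d : ℕ} (b : ConeBouquet d) : Prop :=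
  ∃ x : Fin d × Metric.ball (0 : ℂ) 1, (x.2 : ℂ) = 0 ∧ b = Quot.mk _ x

/-! Around a point of the fiber product with local orders `a` and `b`, coordinates can be chosen in
which the two maps are `x ^ a` and `y ^ b`, so that the fiber product is the plane curve `x ^ a = y
^ b` in the unit bidisc (`nonempty_fiberChart`). With `d = gcd a b`, this curve splits into the `d`
branches `y ^ (b / d) = ω * x ^ (a / d)`, where `ω ^ d = 1`. As `a / d` and `b / d` are coprime,
each branch is parametrized injectively by a disc, and distinct branches meet only at the origin
(`branchParam_injective`, `exists_branchParam_eq`). The parametrizations are proper, so the topology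
is also that of `d` discs glued at their centers; this is the local picture.

Off the center of such a chart both local orders are one. Hence singular points are isolated, and by
compactness there are finitely many. Pulling the branches apart at every point gives
`BranchedAtlas.Normalization`: its points are pairs (point, branch), its charts are the discs, and
it is a compact Hausdorff complex curve, possibly disconnected. Its connected components are the
required closed Riemann surfaces. Collapsing the fibers over the singular points gives a compact
space with a continuous bijection onto the Hausdorff fiber product, hence a homeomorphism
(`exists_singularRiemannSurface`). -/

open Filter Topology Set

/-! ### Branches of the plane curve `x ^ a = y ^ b`. -/

/-- The `i`-th branch of the plane curve `x ^ a = y ^ b`, for `i < gcd a b`. -/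
noncomputable def branchParam (a b : ℕ) (i : Fin (a.gcd b)) (u : ℂ) : ℂ × ℂ :=
  (u ^ (b / a.gcd b), Complex.exp (2 * Real.pi * Complex.I * ((i : ℕ) / (b : ℂ))) *
    u ^ (a / a.gcd b))

section branchParam

variable {a b : ℕ}

theorem branchParam_zero (ha : 0 < a) (hb : 0 < b) (i : Fin (a.gcd b)) :
    branchParam a b i 0 = 0 := by
  have h1 : b / a.gcd b ≠ 0 :=
    (Nat.div_pos (Nat.gcd_le_right _ hb) (Nat.gcd_pos_of_pos_left _ ha)).ne'
  have h2 : a / a.gcd b ≠ 0 :=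
    (Nat.div_pos (Nat.gcd_le_left _ ha) (Nat.gcd_pos_of_pos_left _ ha)).ne'
  simp [branchParam, h1, h2]

theorem continuous_branchParam (i : Fin (a.gcd b)) : Continuous (branchParam a b i) := by
  unfold branchParam
  fun_prop

/-- These powers are the distinct roots of unity of order `gcd a b`, which tell the branches apart.
-/
theorem branchRoot_pow (hb : 0 < b) (i : Fin (a.gcd b)) :
    Complex.exp (2 * Real.pi * Complex.I * ((i : ℕ) / (b : ℂ))) ^ (b / a.gcd b) =
      Complex.exp (2 * Real.pi * Complex.I * ((i : ℕ) / ((a.gcd b : ℕ) : ℂ))) := by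
  have hd : 0 < a.gcd b := Nat.gcd_pos_of_pos_right _ hb
  rw [← Complex.exp_nat_mul, Nat.cast_div (Nat.gcd_dvd_right a b) (by exact_mod_cast hd.ne')]
  congr 1
  have : (b : ℂ) ≠ 0 := by exact_mod_cast hb.ne'
  have : ((a.gcd b : ℕ) : ℂ) ≠ 0 := by exact_mod_cast hd.ne'
  field_simp

theorem branchRoot_pow_eq_one (hb : 0 < b) (i : Fin (a.gcd b)) :
    Complex.exp (2 * Real.pi * Complex.I * ((i : ℕ) / (b : ℂ))) ^ b = 1 := by
  rw [← Complex.exp_nat_mul]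
  have : (b : ℂ) ≠ 0 := by exact_mod_cast hb.ne'
  rw [show (b : ℂ) * (2 * Real.pi * Complex.I * ((i : ℕ) / (b : ℂ))) =
    (i : ℕ) * (2 * Real.pi * Complex.I) by field_simp]
  exact_mod_cast Complex.exp_int_mul_two_pi_mul_I (i : ℕ)

theorem norm_branchParam_fst (i : Fin (a.gcd b)) (u : ℂ) :
    ‖(branchParam a b i u).1‖ = ‖u‖ ^ (b / a.gcd b) := by
  simp [branchParam]

theorem norm_branchParam_snd (hb : 0 < b) (i : Fin (a.gcd b)) (u : ℂ) :
    ‖(branchParam a b i u).2‖ = ‖u‖ ^ (a / a.gcd b) := by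
  have h := Complex.norm_eq_one_of_pow_eq_one (branchRoot_pow_eq_one hb i) hb.ne'
  rw [branchParam, norm_mul, h, one_mul, norm_pow]

theorem branchParam_fst_mem_ball (hb : 0 < b) {i : Fin (a.gcd b)} {u : ℂ} :
    (branchParam a b i u).1 ∈ Metric.ball (0 : ℂ) 1 ↔ u ∈ Metric.ball (0 : ℂ) 1 := by
  rw [mem_ball_zero_iff, mem_ball_zero_iff, norm_branchParam_fst]
  exact pow_lt_one_iff_of_nonneg (norm_nonneg _)
    (Nat.div_pos (Nat.gcd_le_right _ hb) (Nat.gcd_pos_of_pos_right _ hb)).ne'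

theorem branchParam_snd_mem_ball (ha : 0 < a) (hb : 0 < b) {i : Fin (a.gcd b)} {u : ℂ} :
    (branchParam a b i u).2 ∈ Metric.ball (0 : ℂ) 1 ↔ u ∈ Metric.ball (0 : ℂ) 1 := by
  rw [mem_ball_zero_iff, mem_ball_zero_iff, norm_branchParam_snd hb]
  exact pow_lt_one_iff_of_nonneg (norm_nonneg _)
    (Nat.div_pos (Nat.gcd_le_left _ ha) (Nat.gcd_pos_of_pos_right _ hb)).ne'

theorem branchParam_fst_pow (hb : 0 < b) (i : Fin (a.gcd b)) (u : ℂ) :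
    (branchParam a b i u).1 ^ a = (branchParam a b i u).2 ^ b := by
  simp only [branchParam]
  rw [mul_pow, branchRoot_pow_eq_one hb, one_mul, ← pow_mul, ← pow_mul,
    Nat.div_mul_right_comm (Nat.gcd_dvd_right a b), Nat.div_mul_right_comm (Nat.gcd_dvd_left a b),
    mul_comm b a]

/-- Off the origin, `y ^ (b / d) / x ^ (a / d)` is the root of unity attached to the branch, so it
determines the index. Then `u / v` is a root of unity for both of the coprime exponents `a / d` and
`b / d`, hence equals one. -/
theorem branchParam_injective (hb : 0 < b) {i j : Fin (a.gcd b)} {u v : ℂ}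
    (h : branchParam a b i u = branchParam a b j v) : u = v ∧ (u = 0 ∨ i = j) := by
  have hd : 0 < a.gcd b := Nat.gcd_pos_of_pos_right _ hb
  have hb' : b / a.gcd b ≠ 0 := (Nat.div_pos (Nat.gcd_le_right _ hb) hd).ne'
  have h1 : u ^ (b / a.gcd b) = v ^ (b / a.gcd b) := congrArg Prod.fst h
  have h2 := congrArg Prod.snd h
  rcases eq_or_ne u 0 with rfl | hu
  · rw [zero_pow hb', eq_comm, pow_eq_zero_iff hb'] at h1
    exact ⟨h1.symm, Or.inl rfl⟩
  have hv : v ≠ 0 := by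
    rintro rfl
    rw [zero_pow hb', pow_eq_zero_iff hb'] at h1
    exact hu h1
  have h3 := congrArg (· ^ (b / a.gcd b)) h2
  simp only [branchParam, mul_pow, branchRoot_pow hb] at h3
  rw [pow_right_comm u, pow_right_comm v, h1] at h3
  have hv' : (v ^ (b / a.gcd b)) ^ (a / a.gcd b) ≠ 0 := by positivity
  have h4 := mul_right_cancel₀ hv' h3
  have hij : i = j := by
    have hp := Complex.isPrimitiveRoot_exp (a.gcd b) hd.ne'
    have e : ∀ k : Fin (a.gcd b),
        Complex.exp (2 * Real.pi * Complex.I * ((k : ℕ) / ((a.gcd b : ℕ) : ℂ)))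
        = Complex.exp (2 * Real.pi * Complex.I / ((a.gcd b : ℕ) : ℂ)) ^ (k : ℕ) := by
      intro k
      rw [← Complex.exp_nat_mul]
      congr 1
      ring
    rw [e, e] at h4
    exact Fin.ext (hp.pow_inj i.2 j.2 h4)
  subst hij
  refine ⟨?_, Or.inr rfl⟩
  have h5 : u ^ (a / a.gcd b) = v ^ (a / a.gcd b) := by
    simp only [branchParam] at h2
    exact mul_left_cancel₀ (Complex.exp_ne_zero _) h2
  have h6 : (u / v) ^ (b / a.gcd b) = 1 := by
    rw [div_pow, h1, div_self (pow_ne_zero _ hv)]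
  have h7 : (u / v) ^ (a / a.gcd b) = 1 := by
    rw [div_pow, h5, div_self (pow_ne_zero _ hv)]
  have h8 := pow_gcd_eq_one.2 ⟨h7, h6⟩
  rw [Nat.Coprime.gcd_eq_one (Nat.coprime_div_gcd_div_gcd hd), pow_one] at h8
  exact (div_eq_one_iff_eq hv).1 h8

/-- The quotient `y ^ (b / d) / x ^ (a / d)` is a `d`-th root of unity and selects the branch. A `(b
/ d)`-th root `u₀` of `x` then gives `y` up to a factor `τ` with `τ ^ (b / d) = 1`. Since `a / d` is
invertible modulo `b / d`, multiplying `u₀` by a suitable power of `τ` corrects `y` without changing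
`x`. -/
theorem exists_branchParam_eq (ha : 0 < a) (hb : 0 < b) {x y : ℂ} (h : x ^ a = y ^ b) :
    ∃ i u, branchParam a b i u = (x, y) := by
  have hd : 0 < a.gcd b := Nat.gcd_pos_of_pos_right _ hb
  have hb' : 0 < b / a.gcd b := Nat.div_pos (Nat.gcd_le_right _ hb) hd
  rcases eq_or_ne x 0 with rfl | hx
  · refine ⟨⟨0, hd⟩, 0, ?_⟩
    rw [branchParam_zero ha hb]
    rw [zero_pow ha.ne', eq_comm, pow_eq_zero_iff hb.ne'] at h
    rw [h]; rfl
  obtain ⟨u₀, hu₀⟩ := IsAlgClosed.exists_pow_nat_eq x hb'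
  have hu₀0 : u₀ ≠ 0 := by
    rintro rfl
    exact hx (by rw [← hu₀, zero_pow hb'.ne'])
  have hp := Complex.isPrimitiveRoot_exp (a.gcd b) hd.ne'
  have : NeZero (a.gcd b) := ⟨hd.ne'⟩
  have ea : a / a.gcd b * a.gcd b = a := Nat.div_mul_cancel (Nat.gcd_dvd_left a b)
  have eb : b / a.gcd b * a.gcd b = b := Nat.div_mul_cancel (Nat.gcd_dvd_right a b)
  have hw : (y ^ (b / a.gcd b) / x ^ (a / a.gcd b)) ^ (a.gcd b) = 1 := by
    rw [div_pow, ← pow_mul, ← pow_mul, ea, eb, h, div_self]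
    rw [← h]; exact pow_ne_zero _ hx
  obtain ⟨i, hi, hiw⟩ := hp.eq_pow_of_pow_eq_one hw
  set η := Complex.exp (2 * Real.pi * Complex.I * ((i : ℕ) / (b : ℂ))) with hη
  have hη' : η ^ (b / a.gcd b) = y ^ (b / a.gcd b) / x ^ (a / a.gcd b) := by
    rw [← hiw, hη, branchRoot_pow hb ⟨i, hi⟩, ← Complex.exp_nat_mul]
    congr 1
    push_cast
    ring
  have hη0 : η ≠ 0 := Complex.exp_ne_zero _
  set τ := y / (η * u₀ ^ (a / a.gcd b)) with hτ
  have hτ1 : τ ^ (b / a.gcd b) = 1 := by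
    rw [hτ, div_pow, mul_pow, hη', pow_right_comm, hu₀,
      div_mul_cancel₀ _ (pow_ne_zero _ hx), div_self]
    intro h0
    rw [pow_eq_zero_iff hb'.ne'] at h0
    rw [h0, zero_pow hb.ne'] at h
    exact hx ((pow_eq_zero_iff ha.ne').1 h)
  obtain ⟨κ, hκ1, hκ2⟩ : ∃ κ : ℂ, κ ^ (b / a.gcd b) = 1 ∧ κ ^ (a / a.gcd b) = τ := by
    obtain ⟨m, hm⟩ : ∃ m : ℕ, a / a.gcd b * m ≡ 1 [MOD b / a.gcd b] :=
      by
      obtain ⟨m, -, hm⟩ := Nat.exists_mul_mod_eq_of_coprime 1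
        (Nat.coprime_div_gcd_div_gcd (m := a) (n := b) hd) hb'.ne'
      exact ⟨m, hm⟩
    refine ⟨τ ^ m, by rw [pow_right_comm, hτ1, one_pow], ?_⟩
    rw [← pow_mul, mul_comm, pow_eq_pow_mod _ hτ1, hm, ← pow_eq_pow_mod _ hτ1, pow_one]
  refine ⟨⟨i, hi⟩, κ * u₀, ?_⟩
  simp only [branchParam, mul_pow, hκ1, hκ2, hu₀, one_mul, Prod.mk.injEq, true_and]
  rw [← hη, hτ]
  field_simp

/-- The norm of the first coordinate is a positive power of `‖u‖`, so each branch is a proper map,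
hence closed. -/
theorem isClosed_iUnion_image_branchParam (hb : 0 < b)
    {K : Fin (a.gcd b) → Set ℂ} (hK : ∀ i, IsClosed (K i)) :
    IsClosed (⋃ i, branchParam a b i '' K i) := by
  refine isClosed_iUnion_of_finite fun i => ?_
  have hd : 0 < a.gcd b := Nat.gcd_pos_of_pos_right _ hb
  have hb' : 0 < b / a.gcd b := Nat.div_pos (Nat.gcd_le_right _ hb) hd
  have hp : IsProperMap (branchParam a b i) := by
    refine isProperMap_iff_tendsto_cocompact.2 ⟨continuous_branchParam i, ?_⟩
    rw [← Metric.cobounded_eq_cocompact, ← Metric.cobounded_eq_cocompact,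
      ← tendsto_norm_atTop_iff_cobounded]
    refine tendsto_atTop_mono (fun u => (norm_branchParam_fst i u).symm.le.trans (norm_fst_le _)) ?_
    exact (tendsto_pow_atTop hb'.ne').comp tendsto_norm_cobounded_atTop
  exact hp.isClosedMap _ (hK i)

end branchParam

/-! ### Local normal form of holomorphic maps and its consequences. -/

theorem AnalyticAt.exists_pow_eq_of_ne_zero {h : ℂ → ℂ} {z₀ : ℂ} (hh : AnalyticAt ℂ h z₀)
    (h0 : h z₀ ≠ 0) {n : ℕ} (hn : 0 < n) :
    ∃ k : ℂ → ℂ, AnalyticAt ℂ k z₀ ∧ k z₀ ≠ 0 ∧ ∀ᶠ z in 𝓝 z₀, k z ^ n = h z := by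
  obtain ⟨c, hc⟩ := IsAlgClosed.exists_pow_nat_eq (h z₀) hn
  have hc0 : c ≠ 0 := by
    rintro rfl
    exact h0 (by rw [← hc, zero_pow hn.ne'])
  -- Dividing by `h z₀` brings the value at `z₀` to one, inside the slit plane where the logarithm
  -- is analytic.
  have hq : AnalyticAt ℂ (fun z => h z / h z₀) z₀ := hh.div analyticAt_const h0
  refine ⟨fun z => c * Complex.exp (Complex.log (h z / h z₀) / n), ?_, ?_, ?_⟩
  · refine analyticAt_const.mul ((AnalyticAt.div (hq.clog ?_) analyticAt_const ?_).cexp)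
    · rw [div_self h0]; exact Complex.one_mem_slitPlane
    · exact_mod_cast hn.ne'
  · exact mul_ne_zero hc0 (Complex.exp_ne_zero _)
  · filter_upwards [hh.continuousAt.eventually_ne h0] with z hz
    rw [mul_pow, ← Complex.exp_nat_mul, mul_div_cancel₀ _ (by exact_mod_cast hn.ne'),
      Complex.exp_log (div_ne_zero hz h0), hc, mul_div_cancel₀ _ h0]

/-- Write `g z = (z - z₀) ^ n * h z` with `h z₀ ≠ 0` and `h = k ^ n`. The function `(z - z₀) * k z`
has derivative `k z₀ ≠ 0` at `z₀`, so the inverse function theorem makes it a coordinate. -/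
theorem AnalyticAt.exists_openPartialHomeomorph_pow_eq {g : ℂ → ℂ} {z₀ : ℂ}
    (hg : AnalyticAt ℂ g z₀) {n : ℕ} (hn : 0 < n) (hord : analyticOrderAt g z₀ = n) :
    ∃ T : OpenPartialHomeomorph ℂ ℂ, z₀ ∈ T.source ∧ T z₀ = 0 ∧ DifferentiableOn ℂ T T.source ∧
      DifferentiableOn ℂ T.symm T.target ∧ ∀ z ∈ T.source, g z = T z ^ n := by
  obtain ⟨h, hh, h0, hgh⟩ := hg.analyticOrderAt_eq_natCast.1 hord
  obtain ⟨k, hk, hk0, hkh⟩ := hh.exists_pow_eq_of_ne_zero h0 hn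
  set t : ℂ → ℂ := fun z => (z - z₀) * k z with ht
  have hta : AnalyticAt ℂ t z₀ := (analyticAt_id.sub analyticAt_const).mul hk
  have htd : HasDerivAt t (k z₀) z₀ := by
    have := ((hasDerivAt_id z₀).sub_const z₀).mul hk.differentiableAt.hasDerivAt
    have e : t = (fun z => id z - z₀) * k := rfl
    rw [e]
    simpa using this
  have hd0 : deriv t z₀ ≠ 0 := by rw [htd.deriv]; exact hk0
  let T₀ := ContDiffAt.toOpenPartialHomeomorph (n := ω) t
    (f' := ContinuousLinearEquiv.unitsEquivAut ℂ (Units.mk0 _ hk0)) (a := z₀)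
    hta.contDiffAt (by convert! htd.hasFDerivAt using 1) (by simp)
  have hT₀ : ∀ z, T₀ z = t z := fun z => rfl
  -- The source is shrunk until the derivative vanishes nowhere on it, so that the inverse is
  -- differentiable on the whole target.
  have hev : ∀ᶠ z in 𝓝 z₀, AnalyticAt ℂ t z ∧ deriv t z ≠ 0 ∧ g z = t z ^ n := by
    filter_upwards [hta.eventually_analyticAt, hta.deriv.continuousAt.eventually_ne hd0, hgh, hkh]
      with z h1 h2 h3 h4
    refine ⟨h1, h2, ?_⟩
    rw [h3, ht, mul_pow, h4, smul_eq_mul]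
  obtain ⟨W, hW, hWo, hzW⟩ := eventually_nhds_iff.1 hev
  refine ⟨T₀.restrOpen W hWo, ⟨ContDiffAt.mem_toOpenPartialHomeomorph_source _ _ _, hzW⟩,
    ?_, ?_, ?_, ?_⟩
  · change t z₀ = 0
    simp [ht]
  · intro z hz
    exact (hW z hz.2).1.differentiableAt.differentiableWithinAt
  · intro y hy
    have hs := (T₀.restrOpen W hWo).map_target hy
    have h1 := hW _ hs.2
    refine DifferentiableAt.differentiableWithinAt ?_
    exact ((T₀.restrOpen W hWo).hasDerivAt_symm hy h1.2.1
      h1.1.differentiableAt.hasDerivAt).differentiableAt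
  · intro z hz
    exact (hW z hz.2).2.2

theorem exists_mem_nhds_injOn_pow {t : ℂ} (ht : t ≠ 0) {n : ℕ} (hn : 0 < n) :
    ∃ N ∈ 𝓝 t, InjOn (fun x : ℂ => x ^ n) N := by
  have h : HasStrictDerivAt (fun x : ℂ => x ^ n) (n * t ^ (n - 1)) t := hasStrictDerivAt_pow n t
  have h0 : (n : ℂ) * t ^ (n - 1) ≠ 0 :=
    mul_ne_zero (by exact_mod_cast hn.ne') (pow_ne_zero _ ht)
  have h' := h.hasStrictFDerivAt_equiv h0
  exact ⟨_, h'.toOpenPartialHomeomorph _ |>.open_source.mem_nhds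
    h'.mem_toOpenPartialHomeomorph_source, (h'.toOpenPartialHomeomorph _).injOn⟩

/-- Away from the center of a normal form the map is locally injective. This yields local order one
there, and also that local constancy does not spread. -/
theorem injOn_nhds_of_pow_eq {X : Type u} {Y : Type v} [TopologicalSpace X] {f : X → Y}
    {T : OpenPartialHomeomorph X ℂ} {n : ℕ} (hn : 0 < n)
    (hT : ∀ x ∈ T.source, ∀ y ∈ T.source, f x = f y → T x ^ n = T y ^ n) {x : X}
    (hx : x ∈ T.source) (hx0 : T x ≠ 0) : ∃ N ∈ 𝓝 x, InjOn f N := by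
  obtain ⟨N, hN, hinj⟩ := exists_mem_nhds_injOn_pow hx0 hn
  refine ⟨T.source ∩ T ⁻¹' N, inter_mem (T.open_source.mem_nhds hx)
    ((T.continuousAt hx).preimage_mem_nhds hN), ?_⟩
  intro a ha b hb hab
  exact T.injOn ha.1 hb.1 (hinj ha.2 hb.2 (hT a ha.1 b hb.1 hab))

theorem punctured_nhds_neBot_of_chart {X : Type u} [TopologicalSpace X] [ChartedSpace ℂ X]
    (x : X) : (𝓝[≠] x).NeBot := by
  have hx := mem_chart_source ℂ x
  have h : (𝓝[≠] (chartAt ℂ x x)).NeBot := inferInstance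
  rw [← mem_closure_iff_nhdsWithin_neBot, mem_closure_iff_nhds] at h ⊢
  intro t ht
  have h1 : (chartAt ℂ x).symm ⁻¹' t ∈ 𝓝 (chartAt ℂ x x) := by
    refine ((chartAt ℂ x).symm.continuousAt ((chartAt ℂ x).map_source hx)).preimage_mem_nhds ?_
    rwa [(chartAt ℂ x).left_inv hx]
  obtain ⟨y, hy, hy'⟩ := h _ (inter_mem h1
    ((chartAt ℂ x).open_target.mem_nhds ((chartAt ℂ x).map_source hx)))
  refine ⟨_, hy.1, ?_⟩
  rintro (h2 : _ = x)
  apply hy'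
  have := (chartAt ℂ x).right_inv hy.2
  rw [h2] at this
  exact this.symm

theorem not_eventually_const_of_injOn {X : Type u} {Y : Type v} [TopologicalSpace X]
    [ChartedSpace ℂ X] {f : X → Y} {x : X} {N : Set X} (hN : N ∈ 𝓝 x)
    (hinj : InjOn f N) {c : Y} : ¬ ∀ᶠ y in 𝓝 x, f y = c := by
  intro h
  have := punctured_nhds_neBot_of_chart x
  obtain ⟨y, ⟨hy, hyN⟩, hyx⟩ := (((h.and hN).filter_mono nhdsWithin_le_nhds).and
    (self_mem_nhdsWithin (s := {x}ᶜ))).exists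
  exact hyx (hinj hyN (mem_of_mem_nhds hN) (hy.trans h.self_of_nhds.symm))

section normalForm

variable {X : Type u} {Y : Type v} [TopologicalSpace X] [ChartedSpace ℂ X] [IsManifold 𝓘(ℂ) ω X]
  [TopologicalSpace Y] [ChartedSpace ℂ Y] [IsManifold 𝓘(ℂ) ω Y]

theorem isManifold_one_of_omega (X : Type u) [TopologicalSpace X] [ChartedSpace ℂ X]
    [IsManifold 𝓘(ℂ) ω X] : IsManifold 𝓘(ℂ) 1 X :=
  IsManifold.of_le (n := ω) (by simp)

/-- Not being locally constant is what makes the order of vanishing finite; `f z` being subtracted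
makes it positive. -/
theorem IsHolomorphicMap.exists_chart_pow_eq {f : X → Y} (hf : IsHolomorphicMap f) {z : X}
    (hz : ¬ ∀ᶠ x in 𝓝 z, f x = f z) :
    0 < localOrder f z ∧ ∃ T : OpenPartialHomeomorph X ℂ, T.MDifferentiable 𝓘(ℂ) 𝓘(ℂ) ∧
      z ∈ T.source ∧ T z = 0 ∧ ∀ x ∈ T.source, f x ∈ (chartAt ℂ (f z)).source ∧
        chartAt ℂ (f z) (f x) - chartAt ℂ (f z) (f z) = T x ^ localOrder f z := by
  have := isManifold_one_of_omega X
  have := isManifold_one_of_omega Y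
  set e := chartAt ℂ z
  set e' := chartAt ℂ (f z)
  have hfc : Continuous f := MDifferentiable.continuous hf
  have hez : z ∈ e.source := mem_chart_source ℂ z
  have he'z : f z ∈ e'.source := mem_chart_source ℂ (f z)
  set g : ℂ → ℂ := fun t => e' (f (e.symm t)) - e' (f z) with hg
  have hO : IsOpen (e.source ∩ f ⁻¹' e'.source) :=
    e.open_source.inter (e'.open_source.preimage hfc)
  have hN : e.target ∩ e.symm ⁻¹' (f ⁻¹' e'.source) ∈ 𝓝 (e z) := by
    refine (e.isOpen_inter_preimage_symm (e'.open_source.preimage hfc)).mem_nhds ?_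
    refine ⟨e.map_source hez, ?_⟩
    simpa [e.left_inv hez] using he'z
  have hgd : DifferentiableOn ℂ g (e.target ∩ e.symm ⁻¹' (f ⁻¹' e'.source)) := by
    intro t ht
    have h1 : MDifferentiableAt 𝓘(ℂ) 𝓘(ℂ) e.symm t :=
      mdifferentiableAt_atlas_symm (chart_mem_atlas ℂ z) ht.1
    have h2 : MDifferentiableAt 𝓘(ℂ) 𝓘(ℂ) e' (f (e.symm t)) :=
      mdifferentiableAt_atlas (chart_mem_atlas ℂ (f z)) ht.2
    have h3 : MDifferentiableAt 𝓘(ℂ) 𝓘(ℂ) (fun t => e' (f (e.symm t))) t :=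
      h2.comp t ((hf _).comp t h1)
    exact (h3.differentiableAt.sub_const _).differentiableWithinAt
  have hga : AnalyticAt ℂ g (e z) := hgd.analyticAt hN
  have hgz : g (e z) = 0 := by simp [hg, e.left_inv hez]
  have htop : analyticOrderAt g (e z) ≠ ⊤ := by
    intro h
    apply hz
    rw [analyticOrderAt_eq_top] at h
    filter_upwards [(e.continuousAt hez).eventually h, hO.mem_nhds ⟨hez, he'z⟩] with x hx hxs
    rw [hg] at hx
    simp only [e.left_inv hxs.1, sub_eq_zero] at hx
    exact e'.injOn hxs.2 he'z hx
  have hord : analyticOrderAt g (e z) = (localOrder f z : ℕ) :=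
    (Nat.cast_analyticOrderNatAt htop).symm
  have hpos : 0 < localOrder f z := by
    rw [Nat.pos_iff_ne_zero]
    intro h
    rw [h] at hord
    exact hga.analyticOrderAt_ne_zero.2 hgz (by simpa using hord)
  refine ⟨hpos, ?_⟩
  obtain ⟨T, hzT, hT0, hTd, hTd', hTg⟩ := hga.exists_openPartialHomeomorph_pow_eq hpos hord
  have hTm : T.MDifferentiable 𝓘(ℂ) 𝓘(ℂ) :=
    ⟨hTd.mdifferentiableOn, hTd'.mdifferentiableOn⟩
  have hm := (mdifferentiable_chart (I := 𝓘(ℂ)) z).trans hTm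
  refine ⟨(e.trans T).restrOpen (f ⁻¹' e'.source) (e'.open_source.preimage hfc),
    ⟨?_, ?_⟩, ?_, ?_, ?_⟩
  · exact hm.1.mono fun x hx => hx.1
  · exact hm.2.mono fun x hx => hx.1
  · refine ⟨?_, he'z⟩
    rw [OpenPartialHomeomorph.trans_source]
    exact ⟨hez, hzT⟩
  · exact hT0
  · intro x hx
    refine ⟨hx.2, ?_⟩
    have hx1 : x ∈ (e.trans T).source := hx.1
    rw [OpenPartialHomeomorph.trans_source] at hx1
    have := hTg (e x) hx1.2
    rw [hg] at this
    simp only [e.left_inv hx1.1] at this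
    exact this

/-- If the order were `n ≥ 2`, the points of coordinates `t` and `ζ * t`, with `ζ` a primitive
`n`-th root of unity, would have the same image for every small `t`. -/
theorem IsHolomorphicMap.localOrder_eq_one_of_injOn {f : X → Y} (hf : IsHolomorphicMap f) {z : X}
    (hz : ¬ ∀ᶠ x in 𝓝 z, f x = f z) {N : Set X} (hN : N ∈ 𝓝 z) (hinj : InjOn f N) :
    localOrder f z = 1 := by
  obtain ⟨hpos, T, -, hzT, hT0, hT⟩ := hf.exists_chart_pow_eq hz
  by_contra hne
  have hp := Complex.isPrimitiveRoot_exp _ hpos.ne'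
  set ζ := Complex.exp (2 * Real.pi * Complex.I / (localOrder f z : ℂ))
  have hζ : ζ ≠ 1 := hp.ne_one (by omega)
  have hM : T.target ∩ T.symm ⁻¹' (interior N) ∈ 𝓝 (0 : ℂ) := by
    refine (T.isOpen_inter_preimage_symm isOpen_interior).mem_nhds ?_
    rw [← hT0]
    refine ⟨T.map_source hzT, ?_⟩
    rw [mem_preimage, T.left_inv hzT]
    exact mem_interior_iff_mem_nhds.2 hN
  have h1 : ∀ᶠ t : ℂ in 𝓝 0, t ∈ T.target ∩ T.symm ⁻¹' (interior N) := hM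
  have h2 : ∀ᶠ t : ℂ in 𝓝 0, ζ * t ∈ T.target ∩ T.symm ⁻¹' (interior N) := by
    have : ContinuousAt (fun t : ℂ => ζ * t) 0 := by fun_prop
    refine this.eventually ?_
    simpa using h1
  obtain ⟨t, ⟨ht1, ht2⟩, ht0⟩ :=
    (((h1.and h2).filter_mono nhdsWithin_le_nhds).and
      (self_mem_nhdsWithin (s := {(0 : ℂ)}ᶜ))).exists
  have e1 := hT _ (T.map_target ht1.1)
  have e2 := hT _ (T.map_target ht2.1)
  rw [T.right_inv ht1.1] at e1
  rw [T.right_inv ht2.1, mul_pow, hp.pow_eq_one, one_mul, ← e1.2] at e2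
  have e3 := hinj (interior_subset ht2.2) (interior_subset ht1.2)
    ((chartAt ℂ (f z)).injOn e2.1 e1.1 (sub_left_injective e2.2))
  have e4 := T.symm.injOn ht2.1 ht1.1 e3
  have ht0' : t ≠ 0 := ht0
  exact hζ (mul_right_cancel₀ ht0' (by rw [e4, one_mul]))

/-- The points near which `f` is constant form an open set. Its complement is open too: around a
point of it, the normal form makes `f` locally injective off the center. -/
theorem IsHolomorphicMap.not_eventually_const [PreconnectedSpace X] {f : X → Y}
    (hf : IsHolomorphicMap f) (hc : ¬ ∃ c, ∀ z, f z = c) (z : X) :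
    ¬ ∀ᶠ x in 𝓝 z, f x = f z := by
  intro hz
  have hopen : IsOpen {z | ∀ᶠ x in 𝓝 z, f x = f z} := by
    rw [isOpen_iff_mem_nhds]
    intro z hz
    filter_upwards [eventually_eventually_nhds.2 hz] with x hx
    filter_upwards [hx] with y hy
    rw [hy, hx.self_of_nhds]
  have hclosed : IsClosed {z | ∀ᶠ x in 𝓝 z, f x = f z} := by
    rw [← isOpen_compl_iff, isOpen_iff_mem_nhds]
    intro z hz
    obtain ⟨hpos, T, -, hzT, hT0, hT⟩ := hf.exists_chart_pow_eq hz
    filter_upwards [T.open_source.mem_nhds hzT] with x hx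
    by_cases hx0 : T x = 0
    · rwa [T.injOn hx hzT (hx0.trans hT0.symm)]
    · obtain ⟨N, hN, hinj⟩ := injOn_nhds_of_pow_eq (f := f) hpos
        (fun x hx y hy hxy => by rw [← (hT x hx).2, ← (hT y hy).2, hxy]) hx hx0
      exact not_eventually_const_of_injOn hN hinj
  have huniv := IsClopen.eq_univ ⟨hclosed, hopen⟩ ⟨z, hz⟩
  have hlc : IsLocallyConstant f := by
    rw [IsLocallyConstant.iff_eventually_eq]
    intro x
    exact huniv.ge (mem_univ x)
  exact hc ⟨f z, fun x => hlc.apply_eq_of_preconnectedSpace x z⟩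

/-- The image is compact, and it is open because small numbers have small `n`-th roots. Surjectivity
serves to show that the fiber product is nonempty, so that there is at least one component. -/
theorem IsHolomorphicMap.surjective [CompactSpace X] [ConnectedSpace X] [T2Space Y]
    [PreconnectedSpace Y] {f : X → Y}
    (hf : IsHolomorphicMap f) (hc : ¬ ∃ c, ∀ z, f z = c) : Function.Surjective f := by
  have hfc : Continuous f := MDifferentiable.continuous hf
  have hopen : IsOpen (range f) := by
    rw [isOpen_iff_mem_nhds]
    rintro _ ⟨z, rfl⟩
    obtain ⟨hpos, T, -, hzT, hT0, hT⟩ := hf.exists_chart_pow_eq (hf.not_eventually_const hc z)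
    obtain ⟨ε, hε, hball⟩ := Metric.isOpen_iff.1 T.open_target 0 (hT0 ▸ T.map_source hzT)
    set e := chartAt ℂ (f z)
    have hez : f z ∈ e.source := mem_chart_source ℂ (f z)
    have h1 : ∀ᶠ y in 𝓝 (f z), e y ∈ Metric.ball (e (f z)) (ε ^ localOrder f z) :=
      (e.continuousAt hez).eventually (Metric.ball_mem_nhds _ (pow_pos hε _))
    filter_upwards [h1, e.open_source.mem_nhds hez] with y hy hys
    obtain ⟨t, ht⟩ := IsAlgClosed.exists_pow_nat_eq (e y - e (f z)) hpos
    have htb : t ∈ T.target := by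
      apply hball
      rw [Metric.mem_ball, dist_eq_norm, ← ht, norm_pow] at hy
      rw [mem_ball_zero_iff]
      exact lt_of_pow_lt_pow_left₀ _ hε.le hy
    have h2 := hT _ (T.map_target htb)
    rw [T.right_inv htb, ht] at h2
    exact ⟨_, e.injOn h2.1 hys (sub_left_injective h2.2)⟩
  have := IsClopen.eq_univ ⟨(isCompact_range hfc).isClosed, hopen⟩ (range_nonempty f)
  exact range_eq_univ.1 this

end normalForm

/-! ### Normalization of a space with a branched atlas. -/

/-- A topological space covered by finite families of parametrized discs with a common center,
whose parameter changes are holomorphic away from the centers. -/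
structure BranchedAtlas (F : Type u) [TopologicalSpace F] where
  mult : F → ℕ
  mult_pos : ∀ p, 0 < mult p
  param : ∀ p, Fin (mult p) → ℂ → F
  param_zero : ∀ p i, param p i 0 = p
  continuousOn_param : ∀ p i, ContinuousOn (param p i) (Metric.ball 0 1)
  param_injective : ∀ p i j u v, u ∈ Metric.ball (0 : ℂ) 1 → v ∈ Metric.ball (0 : ℂ) 1 →
    param p i u = param p j v → u = v ∧ (u = 0 ∨ i = j)
  mult_param : ∀ p i u, u ∈ Metric.ball (0 : ℂ) 1 → u ≠ 0 → mult (param p i u) = 1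
  -- A neighborhood of `p` meets every branch, so the sets must contain the center all together or
  -- not at all.
  isOpen_iUnion_image : ∀ p (O : Fin (mult p) → Set ℂ), (∀ i, IsOpen (O i)) →
    (∀ i, O i ⊆ Metric.ball 0 1) → (∀ i j, 0 ∈ O i → 0 ∈ O j) → IsOpen (⋃ i, param p i '' O i)
  -- Charts at distinct points of the normalization never overlap at both centers, so that case is
  -- left out.
  differentiableAt_change : ∀ p i q j (f : ℂ → ℂ) (u : ℂ), u ∈ Metric.ball (0 : ℂ) 1 →
    f u ∈ Metric.ball (0 : ℂ) 1 → u ≠ 0 ∨ f u ≠ 0 → ContinuousAt f u →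
    (∀ᶠ t in 𝓝 u, param q j (f t) = param p i t) → DifferentiableAt ℂ f u

namespace BranchedAtlas

variable {F : Type u} [TopologicalSpace F]

/-- The space obtained by pulling apart the branches at each point. -/
@[ext]
structure Normalization (A : BranchedAtlas F) : Type u where
  point : F
  branch : Fin (A.mult point)

variable (A : BranchedAtlas F)

variable {A} in
theorem Normalization.ext_of_mult_eq_one {x y : A.Normalization} (h : x.point = y.point)
    (h1 : A.mult x.point = 1) : x = y := by
  obtain ⟨p, i⟩ := x
  obtain ⟨q, j⟩ := y
  simp only at h h1
  subst h
  congr 1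
  ext
  omega

/-- The disc in the normalization which lifts a parametrized disc. -/
noncomputable def lift (p : F) (i : Fin (A.mult p)) (u : ℂ) : A.Normalization :=
  open Classical in
  -- Off the center the multiplicity is one, so the index `0` is the only branch.
  if u = 0 then ⟨p, i⟩ else ⟨A.param p i u, ⟨0, A.mult_pos _⟩⟩

theorem lift_zero (p : F) (i : Fin (A.mult p)) : A.lift p i 0 = ⟨p, i⟩ := by
  simp [lift]

theorem lift_point (p : F) (i : Fin (A.mult p)) (u : ℂ) :
    (A.lift p i u).point = A.param p i u := by
  unfold lift
  split_ifs with h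
  · rw [h, A.param_zero]
  · rfl

theorem lift_injective {p : F} {i j : Fin (A.mult p)} {u v : ℂ}
    (hu : u ∈ Metric.ball (0 : ℂ) 1) (hv : v ∈ Metric.ball (0 : ℂ) 1)
    (h : A.lift p i u = A.lift p j v) : u = v ∧ i = j := by
  have h1 := congrArg Normalization.point h
  rw [lift_point, lift_point] at h1
  obtain ⟨rfl, h2⟩ := A.param_injective p i j u v hu hv h1
  refine ⟨rfl, h2.elim (fun h0 => ?_) id⟩
  subst h0
  rw [lift_zero, lift_zero] at h
  cases h
  rfl

theorem exists_lift_eq {p : F} {x : A.Normalization} {i : Fin (A.mult p)} {u : ℂ}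
    (hu : u ∈ Metric.ball (0 : ℂ) 1) (h : x.point = A.param p i u) :
    ∃ j, x = A.lift p j u := by
  by_cases h0 : u = 0
  · subst h0
    rw [A.param_zero] at h
    subst h
    exact ⟨x.branch, by rw [lift_zero]⟩
  · refine ⟨i, Normalization.ext_of_mult_eq_one (by rw [h, lift_point]) ?_⟩
    rw [h, A.mult_param p i u hu h0]

/-- The chart of the normalization at a point, as a partial equivalence. -/
noncomputable def chart (x : A.Normalization) : PartialEquiv A.Normalization ℂ :=
  have : Nonempty A.Normalization := ⟨x⟩
  (InjOn.toPartialEquiv (A.lift x.point x.branch) (Metric.ball 0 1)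
    (fun _ hu _ hv h => (A.lift_injective hu hv h).1)).symm

theorem chart_lift (x : A.Normalization) {u : ℂ} (hu : u ∈ Metric.ball (0 : ℂ) 1) :
    A.chart x (A.lift x.point x.branch u) = u :=
  (A.chart x).right_inv hu

theorem mem_chart_source_self (x : A.Normalization) : x ∈ (A.chart x).source :=
  ⟨0, by simp, A.lift_zero _ _⟩

/-- If `v = 0`, there is only one branch. Otherwise the center is removed and the other branches
receive the empty set, so the condition on centers is vacuous. -/
theorem image_param_mem_nhds {p : F} {i : Fin (A.mult p)} {v : ℂ}
    (hv : v ∈ Metric.ball (0 : ℂ) 1) (h1 : A.mult (A.param p i v) = 1) {N : Set ℂ}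
    (hN : N ∈ 𝓝 v) : A.param p i '' N ∈ 𝓝 (A.param p i v) := by
  obtain ⟨W, hWN, hWo, hvW⟩ := mem_nhds_iff.1 (inter_mem hN (Metric.isOpen_ball.mem_nhds hv))
  by_cases h0 : v = 0
  · subst h0
    rw [A.param_zero] at h1
    have hs : Subsingleton (Fin (A.mult p)) := by rw [h1]; infer_instance
    have := A.isOpen_iUnion_image p (fun _ => W) (fun _ => hWo)
      (fun _ => hWN.trans inter_subset_right)
      (fun _ _ h => h)
    refine mem_of_superset (this.mem_nhds (mem_iUnion.2 ⟨i, 0, hvW, rfl⟩)) ?_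
    refine iUnion_subset fun j => ?_
    rw [Subsingleton.elim j i]
    exact image_mono (hWN.trans inter_subset_left)
  · have := A.isOpen_iUnion_image p (fun j => {z | j = i ∧ z ∈ W \ {0}})
      (fun j => by
        by_cases h : j = i
        · simp only [h, true_and]
          exact hWo.sdiff isClosed_singleton
        · simp [h])
      (fun _ z hz => (hWN hz.2.1).2) (fun j k h => absurd rfl h.2.2)
    refine mem_of_superset (this.mem_nhds (mem_iUnion.2 ⟨i, v, ⟨rfl, hvW, h0⟩, rfl⟩)) ?_
    refine iUnion_subset fun j => ?_
    rintro _ ⟨z, ⟨rfl, hz⟩, rfl⟩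
    exact ⟨z, (hWN hz.1).1, rfl⟩

/-- The common point has multiplicity one, because it is off the center of at least one chart. There
the second disc fills a neighborhood in `F`, so parameters near `u` correspond to parameters near
`v`. This gives both openness of chart overlaps and continuity of transitions. -/
theorem change_spec {x y : A.Normalization} (hxy : x ≠ y) {u v : ℂ}
    (hu : u ∈ Metric.ball (0 : ℂ) 1) (hv : v ∈ Metric.ball (0 : ℂ) 1)
    (h : A.lift x.point x.branch u = A.lift y.point y.branch v) :
    (u ≠ 0 ∨ v ≠ 0) ∧ ∀ N ∈ 𝓝 v, ∀ᶠ t in 𝓝 u, ∃ s ∈ N, s ∈ Metric.ball (0 : ℂ) 1 ∧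
      A.lift x.point x.branch t = A.lift y.point y.branch s := by
  have h0 : u ≠ 0 ∨ v ≠ 0 := by
    by_contra! h0
    rw [h0.1, h0.2, lift_zero, lift_zero] at h
    exact hxy h
  have hp := congrArg Normalization.point h
  rw [lift_point, lift_point] at hp
  have h1 : A.mult (A.param y.point y.branch v) = 1 := by
    rcases h0 with h0 | h0
    · rw [← hp]; exact A.mult_param _ _ _ hu h0
    · exact A.mult_param _ _ _ hv h0
  refine ⟨h0, fun N hN => ?_⟩
  have hc : ContinuousAt (A.param x.point x.branch) u :=
    (A.continuousOn_param _ _).continuousAt (Metric.isOpen_ball.mem_nhds hu)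
  have hm := A.image_param_mem_nhds hv h1 (inter_mem hN (Metric.isOpen_ball.mem_nhds hv))
  rw [← hp] at hm
  -- away from the centers, equality of the points gives equality of the lifts
  have hne : ∀ᶠ t in 𝓝 u, t ∈ Metric.ball (0 : ℂ) 1 ∧ (t ≠ 0 ∨ t = u) := by
    filter_upwards [Metric.isOpen_ball.mem_nhds hu,
      (show ∀ᶠ t in 𝓝 u, t ≠ 0 ∨ t = u by
        by_cases hu0 : u = 0
        · subst hu0
          exact Eventually.of_forall fun t => (em (t = 0)).symm
        · exact (eventually_ne_nhds hu0).mono fun t => Or.inl)] with t h1 h2 using ⟨h1, h2⟩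
  filter_upwards [hc.preimage_mem_nhds hm, hne] with t ht ht'
  obtain ⟨s, ⟨hsN, hs1⟩, hs⟩ := ht
  rcases ht'.2 with ht0 | rfl
  · refine ⟨s, hsN, hs1, Normalization.ext_of_mult_eq_one ?_ ?_⟩
    · rw [lift_point, lift_point, hs]
    · rw [lift_point]; exact A.mult_param _ _ _ ht'.1 ht0
  · exact ⟨v, mem_of_mem_nhds hN, hv, h⟩

theorem change_continuousAt {x y : A.Normalization} {u : ℂ}
    (hu : u ∈ Metric.ball (0 : ℂ) 1)
    (h : A.lift x.point x.branch u ∈ (A.chart y).source) :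
    ((A.chart x).symm.trans (A.chart y)).source ∈ 𝓝 u ∧
      ContinuousAt (fun t => A.chart y (A.lift x.point x.branch t)) u ∧
      DifferentiableAt ℂ (fun t => A.chart y (A.lift x.point x.branch t)) u := by
  by_cases hxy : x = y
  · subst hxy
    have e : (fun t => A.chart x (A.lift x.point x.branch t)) =ᶠ[𝓝 u] id := by
      filter_upwards [Metric.isOpen_ball.mem_nhds hu] with t ht
      exact A.chart_lift x ht
    refine ⟨?_, continuousAt_id.congr e.symm, differentiableAt_id.congr_of_eventuallyEq e⟩
    filter_upwards [Metric.isOpen_ball.mem_nhds hu] with t ht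
    exact ⟨ht, t, ht, rfl⟩
  obtain ⟨v, hv, hvu⟩ := h
  obtain ⟨h0, hN⟩ := A.change_spec hxy hu hv hvu.symm
  have hval : A.chart y (A.lift x.point x.branch u) = v := by
    rw [← hvu, A.chart_lift y hv]
  have hc : ContinuousAt (fun t => A.chart y (A.lift x.point x.branch t)) u := by
    intro N hNv
    simp only [hval] at hNv
    rw [mem_map]
    filter_upwards [hN N hNv] with t ⟨s, hsN, hs, hst⟩
    simp only [mem_preimage, hst, A.chart_lift y hs]
    exact hsN
  refine ⟨?_, hc, ?_⟩
  · filter_upwards [hN univ univ_mem, Metric.isOpen_ball.mem_nhds hu] with t ⟨s, _, hs, hst⟩ ht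
    refine ⟨ht, s, hs, ?_⟩
    rw [← hst]; rfl
  · refine A.differentiableAt_change x.point x.branch y.point y.branch _ u hu ?_ ?_ hc ?_
    · simpa only [hval] using hv
    · simpa only [hval] using h0
    · filter_upwards [hN univ univ_mem] with t ⟨s, _, hs, hst⟩
      have := congrArg Normalization.point hst
      rw [lift_point, lift_point] at this
      rw [hst, A.chart_lift y hs, this]

/-- The atlas of the normalization. -/
noncomputable def chartedSpaceCore : ChartedSpaceCore ℂ A.Normalization where
  atlas := range A.chart
  chartAt := A.chart
  mem_chart_source := A.mem_chart_source_self
  chart_mem_atlas x := ⟨x, rfl⟩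
  open_source := by
    rintro _ _ ⟨x, rfl⟩ ⟨y, rfl⟩
    rw [isOpen_iff_mem_nhds]
    rintro u ⟨hu, hu'⟩
    exact (A.change_continuousAt hu hu').1
  continuousOn_toFun := by
    rintro _ _ ⟨x, rfl⟩ ⟨y, rfl⟩ u ⟨hu, hu'⟩
    exact (A.change_continuousAt hu hu').2.1.continuousWithinAt

noncomputable instance : TopologicalSpace A.Normalization := A.chartedSpaceCore.toTopologicalSpace

noncomputable instance : ChartedSpace ℂ A.Normalization := A.chartedSpaceCore.toChartedSpace

theorem chartAt_symm_apply (x : A.Normalization) (u : ℂ) :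
    (chartAt ℂ x).symm u = A.lift x.point x.branch u := rfl

theorem chartAt_source (x : A.Normalization) :
    (chartAt ℂ x).source = A.lift x.point x.branch '' Metric.ball 0 1 := rfl

theorem exists_eq_chartAt {e : OpenPartialHomeomorph A.Normalization ℂ}
    (he : e ∈ atlas ℂ A.Normalization) :
    ∃ x, e = chartAt ℂ x := by
  change e ∈ ⋃ (e : PartialEquiv A.Normalization ℂ) (he : e ∈ A.chartedSpaceCore.atlas),
    {A.chartedSpaceCore.openPartialHomeomorph e he} at he
  simp only [mem_iUnion, mem_singleton_iff] at he
  obtain ⟨e', ⟨x, rfl⟩, rfl⟩ := he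
  exact ⟨x, rfl⟩

instance : IsManifold 𝓘(ℂ) ω A.Normalization := by
  refine isManifold_of_contDiffOn _ _ _ fun e e' he he' => ?_
  obtain ⟨x, rfl⟩ := A.exists_eq_chartAt he
  obtain ⟨y, rfl⟩ := A.exists_eq_chartAt he'
  simp only [modelWithCornersSelf_coe, modelWithCornersSelf_coe_symm, Function.id_comp,
    Function.comp_id, preimage_id, range_id, inter_univ]
  -- Over `ℂ`, differentiability on an open set gives analyticity.
  refine DifferentiableOn.contDiffOn (fun u hu => ?_) (OpenPartialHomeomorph.open_source _)
  exact (A.change_continuousAt hu.1 hu.2).2.2.differentiableWithinAt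

theorem continuous_lift (p : F) (i : Fin (A.mult p)) :
    ContinuousOn (A.lift p i) (Metric.ball 0 1) :=
  (chartAt ℂ (⟨p, i⟩ : A.Normalization)).continuousOn_symm

theorem point_eq_param_chartAt {x y : A.Normalization} (hy : y ∈ (chartAt ℂ x).source) :
    y.point = A.param x.point x.branch (chartAt ℂ x y) := by
  rw [← lift_point, ← chartAt_symm_apply, (chartAt ℂ x).left_inv hy]

theorem continuous_point : Continuous (Normalization.point : A.Normalization → F) := by
  rw [continuous_iff_continuousAt]
  intro x
  have hx := mem_chart_source ℂ x
  have h1 : ContinuousAt (A.param x.point x.branch ∘ chartAt ℂ x) x := by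
    refine ContinuousAt.comp ?_ ((chartAt ℂ x).continuousAt hx)
    exact (A.continuousOn_param _ _).continuousAt
      (Metric.isOpen_ball.mem_nhds ((chartAt ℂ x).map_source hx))
  refine h1.congr ?_
  filter_upwards [(chartAt ℂ x).open_source.mem_nhds hx] with y hy
  exact (A.point_eq_param_chartAt hy).symm

theorem surjective_point : Function.Surjective (Normalization.point : A.Normalization → F) :=
  fun p => ⟨⟨p, ⟨0, A.mult_pos p⟩⟩, rfl⟩

theorem ncard_fiber (p : F) : {x : A.Normalization | x.point = p}.ncard = A.mult p := by
  have e : {x : A.Normalization | x.point = p} = range (fun i => (⟨p, i⟩ : A.Normalization)) := by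
    ext x
    constructor
    · rintro rfl
      exact ⟨x.branch, rfl⟩
    · rintro ⟨i, rfl⟩
      rfl
  rw [e, ← image_univ, ncard_image_of_injective, ncard_univ, Nat.card_fin]
  intro i j h
  simpa using h

/-- Points over distinct points of `F` are separated there; two branches at one point have disjoint
lifted discs. -/
instance [T2Space F] : T2Space A.Normalization := by
  refine ⟨fun x y hxy => ?_⟩
  by_cases h : x.point = y.point
  · refine ⟨_, _, (chartAt ℂ x).open_source, (chartAt ℂ y).open_source, mem_chart_source ℂ x,
      mem_chart_source ℂ y, ?_⟩
    obtain ⟨p, i⟩ := x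
    obtain ⟨q, j⟩ := y
    simp only at h
    subst h
    rw [chartAt_source, chartAt_source, Set.disjoint_left]
    rintro _ ⟨u, hu, rfl⟩ ⟨v, hv, h⟩
    have := (A.lift_injective hv hu h).2
    simp only at this
    exact hxy (by rw [this])
  · exact separated_by_continuous A.continuous_point h

/-- Finitely many bouquets of half-radius discs cover `F`, and the lifts of the closed half-radius
discs are compact and cover the normalization. -/
instance [CompactSpace F] : CompactSpace A.Normalization := by
  have hO : ∀ p, IsOpen (⋃ i, A.param p i '' Metric.ball 0 (1 / 2)) := fun p =>
    A.isOpen_iUnion_image p (fun _ => Metric.ball 0 (1 / 2)) (fun _ => Metric.isOpen_ball)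
      (fun _ => Metric.ball_subset_ball (by norm_num)) (fun _ _ h => h)
  obtain ⟨s, hs⟩ := isCompact_univ.elim_finite_subcover
    (fun p => ⋃ i, A.param p i '' Metric.ball 0 (1 / 2)) hO
    (fun p _ => mem_iUnion.2 ⟨p, mem_iUnion.2 ⟨⟨0, A.mult_pos p⟩, 0, by simp, A.param_zero p _⟩⟩)
  have hK : IsCompact (⋃ p ∈ s, ⋃ i, A.lift p i '' Metric.closedBall 0 (1 / 2)) := by
    refine s.isCompact_biUnion fun p _ => isCompact_iUnion fun i => ?_
    refine (isCompact_closedBall _ _).image_of_continuousOn ((A.continuous_lift p i).mono ?_)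
    exact Metric.closedBall_subset_ball (by norm_num)
  refine ⟨?_⟩
  convert! hK
  refine (eq_univ_of_forall fun x => ?_).symm
  obtain ⟨p, hp, hx⟩ := mem_iUnion₂.1 (hs (mem_univ x.point))
  obtain ⟨i, u, hu, hxu⟩ := mem_iUnion.1 hx
  obtain ⟨j, hj⟩ := A.exists_lift_eq (Metric.ball_subset_ball (by norm_num) hu) hxu.symm
  exact mem_iUnion₂.2 ⟨p, hp, mem_iUnion.2 ⟨j, u, Metric.ball_subset_closedBall hu, hj.symm⟩⟩

theorem isHolomorphicMap_comp_point {Y : Type v} [TopologicalSpace Y] [ChartedSpace ℂ Y]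
    {g : F → Y} (hg : ∀ p i, MDifferentiableOn 𝓘(ℂ) 𝓘(ℂ) (fun u => g (A.param p i u))
      (Metric.ball (0 : ℂ) 1)) :
    IsHolomorphicMap fun x : A.Normalization => g x.point := by
  have := isManifold_one_of_omega A.Normalization
  intro x
  have hx := mem_chart_source ℂ x
  have h1 : MDifferentiableAt 𝓘(ℂ) 𝓘(ℂ) (fun u => g (A.param x.point x.branch u))
      (chartAt ℂ x x) :=
    (hg x.point x.branch).mdifferentiableAt
      (Metric.isOpen_ball.mem_nhds ((chartAt ℂ x).map_source hx))
  have h2 : MDifferentiableAt 𝓘(ℂ) 𝓘(ℂ) (chartAt ℂ x) x :=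
    mdifferentiableAt_atlas (chart_mem_atlas ℂ x) hx
  refine (h1.comp x h2).congr_of_eventuallyEq ?_
  filter_upwards [(chartAt ℂ x).open_source.mem_nhds hx] with y hy
  rw [Function.comp_apply, ← A.point_eq_param_chartAt hy]

end BranchedAtlas

/-! ### From a compact complex curve to a singular Riemann surface. -/

section gluing

theorem SingularRiemannSurface.compactSpace_space (X : SingularRiemannSurface.{u}) :
    CompactSpace X.Space :=
  inferInstance

variable {R : Type u} [TopologicalSpace R]

/-- A connected component of a locally connected space, as an open subset. -/
def componentOpens [LocallyConnectedSpace R] (c : ConnectedComponents R) :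
    TopologicalSpace.Opens R :=
  ⟨ConnectedComponents.mk ⁻¹' {c},
    (isOpen_discrete {c}).preimage ConnectedComponents.continuous_coe⟩

theorem isClosed_componentOpens [LocallyConnectedSpace R] (c : ConnectedComponents R) :
    IsClosed (componentOpens c : Set R) :=
  (isClosed_discrete {c}).preimage ConnectedComponents.continuous_coe

theorem isConnected_componentOpens [LocallyConnectedSpace R] (c : ConnectedComponents R) :
    IsConnected (componentOpens c : Set R) := by
  obtain ⟨x, rfl⟩ := ConnectedComponents.surjective_coe c
  change IsConnected (ConnectedComponents.mk ⁻¹' {(x : ConnectedComponents R)})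
  rw [connectedComponents_preimage_singleton]
  exact isConnected_connectedComponent

variable [ChartedSpace ℂ R] [IsManifold 𝓘(ℂ) ω R]

/-- A connected component of a compact complex manifold of dimension one, as a closed Riemann
surface. -/
@[reducible]
noncomputable def componentSurface [T2Space R] [CompactSpace R] [LocallyConnectedSpace R]
    (c : ConnectedComponents R) : ClosedRiemannSurface.{u} where
  carrier := componentOpens c
  compactSpace := isCompact_iff_compactSpace.1 (isClosed_componentOpens c).isCompact
  connectedSpace := isConnected_iff_connectedSpace.1 (isConnected_componentOpens c)

/-- Gluing finitely many finite fibers of a map from a compact complex manifold of dimension one. -/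
theorem exists_singularRiemannSurface [T2Space R] [CompactSpace R] [Nonempty R]
    {F : Type v} [TopologicalSpace F] [T2Space F] {ν : R → F} (hν : Continuous ν)
    (hsurj : Function.Surjective ν) {S : Set F} (hS : S.Finite)
    (hfib : ∀ p ∈ S, {x | ν x = p}.Finite) (hinj : ∀ x y, ν x = ν y → ν x ∉ S → x = y) :
    ∃ (X : SingularRiemannSurface.{u}) (Φ : X.Space ≃ₜ F) (κ : (Σ i, X.component i) ≃ R),
      (∀ i, IsHolomorphicMap fun x : X.component i => κ ⟨i, x⟩) ∧
      (∀ x, Φ (X.glue x) = ν (κ x)) ∧ Φ '' X.singularities = S := by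
  have : LocallyConnectedSpace R := ChartedSpace.locallyConnectedSpace ℂ R
  -- Components are open by local connectedness, hence finite in number by compactness.
  have : Finite (ConnectedComponents R) := finite_of_compact_of_discrete
  have e := Finite.equivFin (ConnectedComponents R)
  have : Finite S := hS
  have eS := Finite.equivFin S
  let κ : (Σ i : Fin (Nat.card (ConnectedComponents R)),
      componentSurface (R := R) (e.symm i)) ≃ R :=
    { toFun := fun x => x.2.1
      invFun := fun x => ⟨e (x : ConnectedComponents R), x, by
        change (x : ConnectedComponents R) = e.symm (e x)
        rw [e.symm_apply_apply]⟩
      left_inv := by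
        rintro ⟨i, x, hx⟩
        have hx' : (x : ConnectedComponents R) = e.symm i := hx
        have hi : e (x : ConnectedComponents R) = i := by rw [hx', e.apply_symm_apply]
        subst hi
        rfl
      right_inv := fun x => rfl }
  have hκc : Continuous κ := continuous_sigma fun i => continuous_subtype_val
  let X : SingularRiemannSurface.{u} :=
    { numComponents := Nat.card (ConnectedComponents R)
      numComponents_pos := Nat.card_pos
      component := fun i => componentSurface (e.symm i)
      numClasses := Nat.card S
      -- One class for each point of `S`, namely its whole fiber, which may be a single point.
      gluedClass := fun k => {x | ν (κ x) = (eS.symm k : F)}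
      gluedClass_finite := fun k =>
        (hfib _ (eS.symm k).2).preimage (f := κ) κ.injective.injOn
      gluedClass_nonempty := fun k => by
        obtain ⟨x, hx⟩ := hsurj (eS.symm k)
        exact ⟨κ.symm x, by simpa using hx⟩
      gluedClass_disjoint := fun k l hkl => by
        refine Set.disjoint_left.2 ?_
        intro x hx hx'
        apply hkl
        apply eS.symm.injective
        exact Subtype.ext (hx.symm.trans hx') }
  let f : X.Space → F := Quot.lift (fun x => ν (κ x)) (by
    rintro x y ⟨k, hx, hy⟩
    exact hx.trans hy.symm)
  have hfc : Continuous f := continuous_quot_lift _ (hν.comp hκc)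
  have hfb : Function.Bijective f := by
    constructor
    · rintro ⟨x⟩ ⟨y⟩ hxy
      have hxy' : ν (κ x) = ν (κ y) := hxy
      by_cases hx : ν (κ x) ∈ S
      · refine Quot.sound ⟨eS ⟨_, hx⟩, ?_, ?_⟩
        · change ν (κ x) = _
          rw [eS.symm_apply_apply]
        · change ν (κ y) = _
          rw [eS.symm_apply_apply]
          exact hxy'.symm
      · rw [κ.injective (hinj _ _ hxy' hx)]
    · intro p
      obtain ⟨x, rfl⟩ := hsurj p
      exact ⟨Quot.mk _ (κ.symm x), by change ν (κ (κ.symm x)) = _; rw [κ.apply_symm_apply]⟩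
  have := X.compactSpace_space
  let Φ : X.Space ≃ₜ F := Continuous.homeoOfEquivCompactToT2 (f := Equiv.ofBijective f hfb) hfc
  refine ⟨X, Φ, κ, ?_, fun x => rfl, ?_⟩
  · intro i
    exact (contMDiff_subtype_val (I := 𝓘(ℂ)) (n := ω)).mdifferentiable (by simp)
  · ext p
    simp only [SingularRiemannSurface.singularities, mem_image, mem_iUnion]
    constructor
    · rintro ⟨_, ⟨k, x, hx, rfl⟩, rfl⟩
      change ν (κ x) ∈ S
      have hx' : ν (κ x) = (eS.symm k : F) := hx
      rw [hx']
      exact (eS.symm k).2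
    · intro hp
      obtain ⟨x, rfl⟩ := hsurj p
      refine ⟨X.glue (κ.symm x), ⟨eS ⟨_, hp⟩, κ.symm x, ?_, rfl⟩, ?_⟩
      · change ν (κ (κ.symm x)) = _
        rw [eS.symm_apply_apply, κ.apply_symm_apply]
      · change ν (κ (κ.symm x)) = _
        rw [κ.apply_symm_apply]

end gluing

/-! ### Coordinates and branches on the fiber product. -/

/-- Near a nonzero value, `z ↦ z ^ n` has a holomorphic local inverse, and continuity forces `f` to
be that inverse composed with `g`. -/
theorem differentiableAt_of_pow {f g : ℂ → ℂ} {x : ℂ} {n : ℕ} (hn : 0 < n)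
    (hf : ContinuousAt f x) (h0 : f x ≠ 0 ∨ n = 1) (hg : DifferentiableAt ℂ g x)
    (h : ∀ᶠ t in 𝓝 x, f t ^ n = g t) : DifferentiableAt ℂ f x := by
  rcases h0 with h0 | rfl
  · have h1 : HasStrictDerivAt (fun z : ℂ => z ^ n) (n * f x ^ (n - 1)) (f x) :=
      hasStrictDerivAt_pow n (f x)
    have h2 : (n : ℂ) * f x ^ (n - 1) ≠ 0 :=
      mul_ne_zero (by exact_mod_cast hn.ne') (pow_ne_zero _ h0)
    have h3 := (h1.to_localInverse h2).hasDerivAt.differentiableAt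
    have h4 : ∀ᶠ t in 𝓝 x, h1.localInverse _ _ _ h2 (g t) = f t := by
      filter_upwards [hf.eventually ((h1.hasStrictFDerivAt_equiv h2).eventually_left_inverse), h]
        with t h5 h6
      rw [← h6]
      exact h5
    have hgx : g x = f x ^ n := h.self_of_nhds.symm
    rw [← hgx] at h3
    exact (h3.comp x hg).congr_of_eventuallyEq (h4.mono fun t => Eq.symm)
  · refine hg.congr_of_eventuallyEq (h.mono fun t ht => ?_)
    rw [← ht, pow_one]

theorem OpenPartialHomeomorph.exists_rescale {X : Type u} [TopologicalSpace X] [ChartedSpace ℂ X]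
    {T : OpenPartialHomeomorph X ℂ} (hT : T.MDifferentiable 𝓘(ℂ) 𝓘(ℂ)) {z : X}
    (hz : z ∈ T.source) (hz0 : T z = 0) {ε : ℝ} (hε : 0 < ε)
    (hball : Metric.ball 0 ε ⊆ T.target) :
    ∃ T' : OpenPartialHomeomorph X ℂ, T'.MDifferentiable 𝓘(ℂ) 𝓘(ℂ) ∧ z ∈ T'.source ∧
      T'.target = Metric.ball 0 1 ∧ T'.source ⊆ T.source ∧ ∀ x, T x = ε * T' x := by
  have hε' : ((ε : ℂ)⁻¹) ≠ 0 := inv_ne_zero (by exact_mod_cast hε.ne')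
  let h := (Homeomorph.mulLeft₀ ((ε : ℂ)⁻¹) hε').toOpenPartialHomeomorph
  have hm : h.MDifferentiable 𝓘(ℂ) 𝓘(ℂ) := by
    constructor
    · have : Differentiable ℂ (fun x : ℂ => (ε : ℂ)⁻¹ * x) := by fun_prop
      exact this.mdifferentiable.mdifferentiableOn
    · have : Differentiable ℂ (fun x : ℂ => ((ε : ℂ)⁻¹)⁻¹ * x) := by fun_prop
      exact this.mdifferentiable.mdifferentiableOn
  have hTm := hT.trans hm
  -- Restricting the inverse cuts down the target, here to the unit disc.
  let T' := ((T.trans h).symm.restrOpen (Metric.ball 0 1) Metric.isOpen_ball).symm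
  have hsrc : T'.source ⊆ (T.trans h).source := by
    intro x hx
    have h1 := T'.map_source hx
    have h2 : T'.symm (T' x) = x := T'.left_inv hx
    rw [← h2]
    exact (T.trans h).map_target h1.1
  have htarget : T'.target = Metric.ball 0 1 := by
    change (T.trans h).target ∩ Metric.ball 0 1 = _
    refine inter_eq_right.2 fun x hx => ?_
    rw [OpenPartialHomeomorph.trans_target]
    refine ⟨mem_univ _, hball ?_⟩
    change ((ε : ℂ)⁻¹)⁻¹ * x ∈ _
    rw [mem_ball_zero_iff] at hx ⊢
    rw [inv_inv, norm_mul, Complex.norm_real, Real.norm_of_nonneg hε.le]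
    nlinarith
  have happ : ∀ x, T x = ε * T' x := by
    intro x
    change T x = ε * ((ε : ℂ)⁻¹ * T x)
    rw [mul_inv_cancel_left₀ (by exact_mod_cast hε.ne')]
  refine ⟨T', ⟨hTm.1.mono hsrc, hTm.2.mono inter_subset_left⟩, ?_, htarget, fun x hx => ?_, happ⟩
  · have h1 : (0 : ℂ) ∈ T'.target := by rw [htarget]; simp
    have h2 := T'.map_target h1
    have h3 : T'.symm 0 = z := by
      change T.symm (((ε : ℂ)⁻¹)⁻¹ * 0) = z
      rw [mul_zero, ← hz0, T.left_inv hz]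
    rwa [h3] at h2
  · have := hsrc hx
    rw [OpenPartialHomeomorph.trans_source] at this
    exact this.1

section fiberProduct

variable {X : Type u} {Y : Type v} {Z : Type w} [TopologicalSpace X] [ChartedSpace ℂ X]
  [TopologicalSpace Y] [ChartedSpace ℂ Y] [TopologicalSpace Z] [ChartedSpace ℂ Z]

/-- Coordinates in which the fiber product of `f` and `g` is, around `p`, the part of the curve
`x ^ a = y ^ b` in the unit bidisc, where `a` and `b` are the local orders. -/
structure FiberChart (f : X → Z) (g : Y → Z) (p : Function.Pullback f g) where
  fst : OpenPartialHomeomorph X ℂ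
  snd : OpenPartialHomeomorph Y ℂ
  fst_mdifferentiable : fst.MDifferentiable 𝓘(ℂ) 𝓘(ℂ)
  snd_mdifferentiable : snd.MDifferentiable 𝓘(ℂ) 𝓘(ℂ)
  fst_mem : p.1.1 ∈ fst.source
  snd_mem : p.1.2 ∈ snd.source
  fst_apply : fst p.1.1 = 0
  snd_apply : snd p.1.2 = 0
  fst_target : fst.target = Metric.ball 0 1
  snd_target : snd.target = Metric.ball 0 1
  order_fst_pos : 0 < localOrder f p.1.1
  order_snd_pos : 0 < localOrder g p.1.2
  fst_pow_eq : ∀ x ∈ fst.source, ∀ y ∈ fst.source, f x = f y →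
    fst x ^ localOrder f p.1.1 = fst y ^ localOrder f p.1.1
  snd_pow_eq : ∀ x ∈ snd.source, ∀ y ∈ snd.source, g x = g y →
    snd x ^ localOrder g p.1.2 = snd y ^ localOrder g p.1.2
  eq_iff : ∀ x ∈ fst.source, ∀ y ∈ snd.source, f x = g y ↔
    fst x ^ localOrder f p.1.1 = snd y ^ localOrder g p.1.2

theorem nonempty_fiberChart [IsManifold 𝓘(ℂ) ω X] [IsManifold 𝓘(ℂ) ω Y] [IsManifold 𝓘(ℂ) ω Z]
    {f : X → Z} {g : Y → Z} (hf : IsHolomorphicMap f) (hg : IsHolomorphicMap g)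
    (p : Function.Pullback f g) (hfp : ¬ ∀ᶠ x in 𝓝 p.1.1, f x = f p.1.1)
    (hgp : ¬ ∀ᶠ y in 𝓝 p.1.2, g y = g p.1.2) : Nonempty (FiberChart f g p) := by
  obtain ⟨ha, T, hT, hzT, hT0, hTf⟩ := hf.exists_chart_pow_eq hfp
  obtain ⟨hb, S, hS, hzS, hS0, hSg⟩ := hg.exists_chart_pow_eq hgp
  have hp : f p.1.1 = g p.1.2 := p.2
  -- Both normal forms now refer to the same chart of `Z`.
  rw [← hp] at hSg
  set a := localOrder f p.1.1
  set b := localOrder g p.1.2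
  set e := chartAt ℂ (f p.1.1)
  obtain ⟨ε₁, hε₁, hb₁⟩ := Metric.isOpen_iff.1 T.open_target 0 (hT0 ▸ T.map_source hzT)
  obtain ⟨ε₂, hε₂, hb₂⟩ := Metric.isOpen_iff.1 S.open_target 0 (hS0 ▸ S.map_source hzS)
  -- The first coordinate is rescaled by `c ^ b` and the second by `c ^ a`. Both sides of the
  -- equation then acquire the factor `c ^ (a * b)`, which cancels and leaves `x ^ a = y ^ b`.
  obtain ⟨c, hc0, hc⟩ : ∃ c : ℝ, 0 < c ∧ c ≤ min 1 (min ε₁ ε₂) :=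
    ⟨_, lt_min one_pos (lt_min hε₁ hε₂), le_rfl⟩
  have hc1 : c ≤ 1 := hc.trans (min_le_left _ _)
  have hcb : c ^ b ≤ ε₁ := (pow_le_of_le_one hc0.le hc1 hb.ne').trans
    (hc.trans ((min_le_right _ _).trans (min_le_left _ _)))
  have hca : c ^ a ≤ ε₂ := (pow_le_of_le_one hc0.le hc1 ha.ne').trans
    (hc.trans ((min_le_right _ _).trans (min_le_right _ _)))
  obtain ⟨T', hT', hzT', hTt, hTs, hTT⟩ := T.exists_rescale hT hzT hT0 (pow_pos hc0 b)
    ((Metric.ball_subset_ball hcb).trans hb₁)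
  obtain ⟨S', hS', hzS', hSt, hSs, hSS⟩ := S.exists_rescale hS hzS hS0 (pow_pos hc0 a)
    ((Metric.ball_subset_ball hca).trans hb₂)
  have hcc : (c : ℂ) ≠ 0 := by exact_mod_cast hc0.ne'
  have hT'f : ∀ x ∈ T'.source, f x ∈ e.source ∧
      e (f x) - e (f p.1.1) = (c : ℂ) ^ (a * b) * T' x ^ a := fun x hx => by
    refine ⟨(hTf x (hTs hx)).1, ?_⟩
    rw [(hTf x (hTs hx)).2, hTT x, mul_pow]
    push_cast
    ring
  have hS'g : ∀ y ∈ S'.source, g y ∈ e.source ∧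
      e (g y) - e (f p.1.1) = (c : ℂ) ^ (a * b) * S' y ^ b := fun y hy => by
    refine ⟨(hSg y (hSs hy)).1, ?_⟩
    rw [(hSg y (hSs hy)).2, hSS y, mul_pow]
    push_cast
    ring
  have hc' : (c : ℂ) ^ (a * b) ≠ 0 := pow_ne_zero _ hcc
  refine ⟨{
    fst := T'
    snd := S'
    fst_mdifferentiable := hT'
    snd_mdifferentiable := hS'
    fst_mem := hzT'
    snd_mem := hzS'
    fst_apply := ?_
    snd_apply := ?_
    fst_target := hTt
    snd_target := hSt
    order_fst_pos := ha
    order_snd_pos := hb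
    fst_pow_eq := ?_
    snd_pow_eq := ?_
    eq_iff := ?_ }⟩
  · have := hTT p.1.1
    rw [hT0] at this
    have hne : ((c ^ b : ℝ) : ℂ) ≠ 0 := by exact_mod_cast (pow_pos hc0 b).ne'
    exact (mul_eq_zero.1 this.symm).resolve_left hne
  · have := hSS p.1.2
    rw [hS0] at this
    have hne : ((c ^ a : ℝ) : ℂ) ≠ 0 := by exact_mod_cast (pow_pos hc0 a).ne'
    exact (mul_eq_zero.1 this.symm).resolve_left hne
  · intro x hx y hy hxy
    refine mul_left_cancel₀ hc' ?_
    rw [← (hT'f x hx).2, ← (hT'f y hy).2, hxy]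
  · intro x hx y hy hxy
    refine mul_left_cancel₀ hc' ?_
    rw [← (hS'g x hx).2, ← (hS'g y hy).2, hxy]
  · intro x hx y hy
    rw [← mul_right_inj' hc', ← (hT'f x hx).2, ← (hS'g y hy).2, sub_left_inj]
    exact ⟨fun h => by rw [h], fun h => e.injOn (hT'f x hx).1 (hS'g y hy).1 h⟩

end fiberProduct

section fiberProduct

variable {X : Type u} {Y : Type v} {Z : Type w} [TopologicalSpace X] [ChartedSpace ℂ X]
  [TopologicalSpace Y] [ChartedSpace ℂ Y] [TopologicalSpace Z] [ChartedSpace ℂ Z]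

namespace FiberChart

variable {f : X → Z} {g : Y → Z} {p : Function.Pullback f g} (C : FiberChart f g p)

/-- The domain of the coordinates, in the fiber product. -/
def domain : Set (Function.Pullback f g) :=
  {q | q.1.1 ∈ C.fst.source ∧ q.1.2 ∈ C.snd.source}

theorem isOpen_domain : IsOpen C.domain :=
  (C.fst.open_source.preimage (continuous_fst.comp continuous_subtype_val)).inter
    (C.snd.open_source.preimage (continuous_snd.comp continuous_subtype_val))

theorem mem_domain : p ∈ C.domain := ⟨C.fst_mem, C.snd_mem⟩

/-- The coordinates of a point of the fiber product. -/
noncomputable def coord (q : Function.Pullback f g) : ℂ × ℂ := (C.fst q.1.1, C.snd q.1.2)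

theorem continuousOn_coord : ContinuousOn C.coord C.domain := by
  refine ContinuousOn.prodMk ?_ ?_
  · exact C.fst.continuousOn.comp (continuous_fst.comp continuous_subtype_val).continuousOn
      fun q hq => hq.1
  · exact C.snd.continuousOn.comp (continuous_snd.comp continuous_subtype_val).continuousOn
      fun q hq => hq.2

theorem injOn_coord : InjOn C.coord C.domain := by
  intro q hq q' hq' h
  refine Subtype.ext (Prod.ext ?_ ?_)
  · exact C.fst.injOn hq.1 hq'.1 (congrArg Prod.fst h)
  · exact C.snd.injOn hq.2 hq'.2 (congrArg Prod.snd h)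

variable {i j : Fin ((localOrder f p.1.1).gcd (localOrder g p.1.2))} {t : ℂ}

theorem branchParam_fst_mem (ht : t ∈ Metric.ball (0 : ℂ) 1) :
    (branchParam _ _ i t).1 ∈ C.fst.target := by
  rw [C.fst_target]
  exact (branchParam_fst_mem_ball C.order_snd_pos).2 ht

theorem branchParam_snd_mem (ht : t ∈ Metric.ball (0 : ℂ) 1) :
    (branchParam _ _ i t).2 ∈ C.snd.target := by
  rw [C.snd_target]
  exact (branchParam_snd_mem_ball C.order_fst_pos C.order_snd_pos).2 ht

open Classical in
/-- The branches of the fiber product at `p`, each parametrized by the unit disc. -/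
noncomputable def param (i : Fin ((localOrder f p.1.1).gcd (localOrder g p.1.2))) (t : ℂ) :
    Function.Pullback f g :=
  if ht : t ∈ Metric.ball (0 : ℂ) 1 then
    ⟨(C.fst.symm (branchParam _ _ i t).1, C.snd.symm (branchParam _ _ i t).2), by
      have h1 := C.branchParam_fst_mem (i := i) ht
      have h2 := C.branchParam_snd_mem (i := i) ht
      rw [C.eq_iff _ (C.fst.map_target h1) _ (C.snd.map_target h2), C.fst.right_inv h1,
        C.snd.right_inv h2]
      exact branchParam_fst_pow C.order_snd_pos i t⟩
  -- A default value; only the unit disc matters.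
  else p

theorem param_val (ht : t ∈ Metric.ball (0 : ℂ) 1) : (C.param i t).1 =
    (C.fst.symm (branchParam _ _ i t).1, C.snd.symm (branchParam _ _ i t).2) := by
  rw [param, dif_pos ht]

theorem param_mem_domain (ht : t ∈ Metric.ball (0 : ℂ) 1) : C.param i t ∈ C.domain := by
  unfold domain
  rw [mem_ofPred_eq, C.param_val ht]
  exact ⟨C.fst.map_target (C.branchParam_fst_mem ht), C.snd.map_target (C.branchParam_snd_mem ht)⟩

theorem coord_param (ht : t ∈ Metric.ball (0 : ℂ) 1) :
    C.coord (C.param i t) = branchParam _ _ i t := by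
  rw [coord, C.param_val ht, C.fst.right_inv (C.branchParam_fst_mem ht),
    C.snd.right_inv (C.branchParam_snd_mem ht)]

theorem coord_self : C.coord p = 0 := by
  rw [coord, C.fst_apply, C.snd_apply]
  rfl

theorem param_zero (i : Fin ((localOrder f p.1.1).gcd (localOrder g p.1.2))) :
    C.param i 0 = p := by
  have h0 : (0 : ℂ) ∈ Metric.ball (0 : ℂ) 1 := by simp
  refine C.injOn_coord (C.param_mem_domain h0) C.mem_domain ?_
  rw [C.coord_param h0, C.coord_self, branchParam_zero C.order_fst_pos C.order_snd_pos]

theorem param_injective {s t : ℂ} (hs : s ∈ Metric.ball (0 : ℂ) 1)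
    (ht : t ∈ Metric.ball (0 : ℂ) 1) (h : C.param i s = C.param j t) : s = t ∧ (s = 0 ∨ i = j) := by
  apply branchParam_injective (a := localOrder f p.1.1) C.order_snd_pos
  rw [← C.coord_param hs, ← C.coord_param ht, h]

theorem exists_param_eq {q : Function.Pullback f g} (hq : q ∈ C.domain) :
    ∃ i, ∃ t ∈ Metric.ball (0 : ℂ) 1, C.param i t = q := by
  obtain ⟨i, t, hit⟩ := exists_branchParam_eq C.order_fst_pos C.order_snd_pos
    ((C.eq_iff _ hq.1 _ hq.2).1 q.2)
  have ht : t ∈ Metric.ball (0 : ℂ) 1 := by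
    rw [← branchParam_fst_mem_ball C.order_snd_pos (i := i), hit, ← C.fst_target]
    exact C.fst.map_source hq.1
  refine ⟨i, t, ht, C.injOn_coord (C.param_mem_domain ht) hq ?_⟩
  rw [C.coord_param ht, hit]
  rfl

theorem mdifferentiableOn_param_fst (i : Fin ((localOrder f p.1.1).gcd (localOrder g p.1.2))) :
    MDifferentiableOn 𝓘(ℂ) 𝓘(ℂ) (fun t => (C.param i t).1.1) (Metric.ball (0 : ℂ) 1) := by
  have h1 : Differentiable ℂ fun t => (branchParam _ _ i t).1 := by
    unfold branchParam
    fun_prop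
  refine (C.fst_mdifferentiable.2.comp h1.mdifferentiable.mdifferentiableOn
    fun t ht => C.branchParam_fst_mem ht).congr fun t ht => ?_
  rw [C.param_val ht]
  rfl

theorem mdifferentiableOn_param_snd (i : Fin ((localOrder f p.1.1).gcd (localOrder g p.1.2))) :
    MDifferentiableOn 𝓘(ℂ) 𝓘(ℂ) (fun t => (C.param i t).1.2) (Metric.ball (0 : ℂ) 1) := by
  have h1 : Differentiable ℂ fun t => (branchParam _ _ i t).2 := by
    unfold branchParam
    fun_prop
  refine (C.snd_mdifferentiable.2.comp h1.mdifferentiable.mdifferentiableOn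
    fun t ht => C.branchParam_snd_mem ht).congr fun t ht => ?_
  rw [C.param_val ht]
  rfl

theorem continuousOn_param (i : Fin ((localOrder f p.1.1).gcd (localOrder g p.1.2))) :
    ContinuousOn (C.param i) (Metric.ball 0 1) := by
  refine (Topology.IsInducing.subtypeVal
    (t := {q : X × Y | f q.1 = g q.2})).continuousOn_iff.2 ?_
  exact (C.mdifferentiableOn_param_fst i).continuousOn.prodMk
    (C.mdifferentiableOn_param_snd i).continuousOn

/-- In coordinates, this union is the complement in the domain of the images of the complements `(O
i)ᶜ`, a closed set by properness. The condition on centers is needed because the origin lies on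
every branch. -/
theorem isOpen_iUnion_image_param
    {O : Fin ((localOrder f p.1.1).gcd (localOrder g p.1.2)) → Set ℂ}
    (hO : ∀ i, IsOpen (O i)) (hb : ∀ i, O i ⊆ Metric.ball 0 1)
    (h0 : ∀ i j, 0 ∈ O i → 0 ∈ O j) : IsOpen (⋃ i, C.param i '' O i) := by
  have hc := isClosed_iUnion_image_branchParam (a := localOrder f p.1.1) C.order_snd_pos
    (K := fun i => (O i)ᶜ) fun i => (hO i).isClosed_compl
  convert! C.continuousOn_coord.isOpen_inter_preimage C.isOpen_domain hc.isOpen_compl using 1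
  ext q
  simp only [mem_iUnion, mem_image, mem_inter_iff, mem_preimage, mem_compl_iff, not_exists, not_and]
  constructor
  · rintro ⟨i, t, ht, rfl⟩
    refine ⟨C.param_mem_domain (hb i ht), fun j s hs h => ?_⟩
    rw [C.coord_param (hb i ht)] at h
    obtain ⟨rfl, hij⟩ := branchParam_injective C.order_snd_pos h
    rcases hij with rfl | rfl
    · exact hs (h0 i j ht)
    · exact hs ht
  · rintro ⟨hq, h⟩
    obtain ⟨i, t, ht, rfl⟩ := C.exists_param_eq hq
    refine ⟨i, t, ?_, rfl⟩
    by_contra hn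
    exact h i t hn (C.coord_param ht).symm

theorem localOrder_fst_eq_one [IsManifold 𝓘(ℂ) ω X] [IsManifold 𝓘(ℂ) ω Z]
    (hf : IsHolomorphicMap f) {x : X} (hx : x ∈ C.fst.source) (h0 : C.fst x ≠ 0) :
    localOrder f x = 1 := by
  obtain ⟨N, hN, hinj⟩ := injOn_nhds_of_pow_eq (f := f) C.order_fst_pos C.fst_pow_eq hx h0
  exact hf.localOrder_eq_one_of_injOn (not_eventually_const_of_injOn hN hinj) hN hinj

theorem localOrder_snd_eq_one [IsManifold 𝓘(ℂ) ω Y] [IsManifold 𝓘(ℂ) ω Z]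
    (hg : IsHolomorphicMap g) {y : Y} (hy : y ∈ C.snd.source) (h0 : C.snd y ≠ 0) :
    localOrder g y = 1 := by
  obtain ⟨N, hN, hinj⟩ := injOn_nhds_of_pow_eq (f := g) C.order_snd_pos C.snd_pow_eq hy h0
  exact hg.localOrder_eq_one_of_injOn (not_eventually_const_of_injOn hN hinj) hN hinj

theorem localOrder_param [IsManifold 𝓘(ℂ) ω X] [IsManifold 𝓘(ℂ) ω Y] [IsManifold 𝓘(ℂ) ω Z]
    (hf : IsHolomorphicMap f) (hg : IsHolomorphicMap g) (ht : t ∈ Metric.ball (0 : ℂ) 1)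
    (h0 : t ≠ 0) :
    localOrder f (C.param i t).1.1 = 1 ∧ localOrder g (C.param i t).1.2 = 1 := by
  have hd := C.param_mem_domain (i := i) ht
  have hc := C.coord_param (i := i) ht
  constructor
  · refine C.localOrder_fst_eq_one hf hd.1 ?_
    have h1 : C.fst (C.param i t).1.1 = (branchParam _ _ i t).1 := congrArg Prod.fst hc
    rw [h1, ← norm_pos_iff, norm_branchParam_fst]
    positivity
  · refine C.localOrder_snd_eq_one hg hd.2 ?_
    have h1 : C.snd (C.param i t).1.2 = (branchParam _ _ i t).2 := congrArg Prod.snd hc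
    rw [h1, ← norm_pos_iff, norm_branchParam_snd C.order_snd_pos]
    positivity

/-- The domain of the coordinates is a bouquet of discs. -/
theorem exists_homeomorph_coneBouquet :
    ∃ h : C.domain ≃ₜ ConeBouquet ((localOrder f p.1.1).gcd (localOrder g p.1.2)),
      (h ⟨p, C.mem_domain⟩).IsVertex := by
  let F : ConeBouquet ((localOrder f p.1.1).gcd (localOrder g p.1.2)) → C.domain :=
    Quot.lift (fun x => ⟨C.param x.1 x.2, C.param_mem_domain x.2.2⟩) (by
      rintro ⟨i, s⟩ ⟨j, t⟩ ⟨hs, ht⟩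
      simp only at hs ht
      simp only [hs, ht, C.param_zero])
  have hFc : Continuous F := by
    refine continuous_quot_lift _ (Continuous.subtype_mk ?_ _)
    rw [continuous_prod_of_discrete_left]
    intro i
    exact (continuousOn_iff_continuous_domRestrict.1 (C.continuousOn_param i))
  have hFb : Function.Bijective F := by
    constructor
    · rintro ⟨i, s⟩ ⟨j, t⟩ h
      obtain ⟨hst, h'⟩ := C.param_injective s.2 t.2 (congrArg Subtype.val h)
      rcases h' with h' | rfl
      · exact Quot.sound ⟨h', hst ▸ h'⟩
      · rw [Subtype.ext hst]
    · rintro ⟨q, hq⟩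
      obtain ⟨i, t, ht, rfl⟩ := C.exists_param_eq hq
      exact ⟨Quot.mk _ (i, ⟨t, ht⟩), rfl⟩
  have hFo : IsOpenMap F := by
    intro V hV
    have hV' : IsOpen (Quot.mk _ ⁻¹' V) := hV.preimage continuous_quot_mk
    -- The slices of the preimage of `V` in the discs contain the center all together or not at all,
    -- since the centers are one point of the bouquet.
    have h1 := C.isOpen_iUnion_image_param
      (O := fun i => Subtype.val '' {t : Metric.ball (0 : ℂ) 1 | Quot.mk _ (i, t) ∈ V})
      (fun i => Metric.isOpen_ball.isOpenMap_subtype_val _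
        (hV'.preimage (Continuous.prodMk_right i)))
      (fun i => by rintro _ ⟨t, -, rfl⟩; exact t.2)
      (fun i j => by
        rintro ⟨t, ht, ht0⟩
        refine ⟨t, ?_, ht0⟩
        have e : (Quot.mk _ (j, t) : ConeBouquet _) = Quot.mk _ (i, t) := Quot.sound ⟨ht0, ht0⟩
        rw [mem_ofPred_eq, e]
        exact ht)
    convert! h1.preimage (continuous_subtype_val (p := (· ∈ C.domain))) using 1
    ext q
    simp only [mem_image, mem_preimage, mem_iUnion]
    constructor
    · rintro ⟨⟨i, t⟩, hx, rfl⟩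
      exact ⟨i, t, ⟨t, hx, rfl⟩, rfl⟩
    · rintro ⟨i, _, ⟨t, ht, rfl⟩, hq⟩
      exact ⟨Quot.mk _ (i, t), ht, Subtype.ext hq⟩
  let H := (Equiv.ofBijective F hFb).toHomeomorphOfContinuousOpen hFc hFo
  have hd : 0 < (localOrder f p.1.1).gcd (localOrder g p.1.2) :=
    Nat.gcd_pos_of_pos_left _ C.order_fst_pos
  refine ⟨H.symm, (⟨0, hd⟩, ⟨0, by simp⟩), rfl, ?_⟩
  rw [Homeomorph.symm_apply_eq]
  exact Subtype.ext (C.param_zero _).symm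

end FiberChart

/-- The first coordinate of `D` along the branch of `C` is holomorphic and equals a power of `τ`, so
`τ` is a continuous root of a holomorphic function. If `τ s = 0`, then `q` lies off the center of
`C`, both orders at `q` are one, and so is the exponent. -/
theorem differentiableAt_param_change [IsManifold 𝓘(ℂ) ω X] [IsManifold 𝓘(ℂ) ω Y]
    [IsManifold 𝓘(ℂ) ω Z] {f : X → Z} {g : Y → Z} {p q : Function.Pullback f g}
    (hf : IsHolomorphicMap f) (hg : IsHolomorphicMap g)
    (C : FiberChart f g p) (D : FiberChart f g q)
    {i : Fin ((localOrder f p.1.1).gcd (localOrder g p.1.2))}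
    {j : Fin ((localOrder f q.1.1).gcd (localOrder g q.1.2))} {τ : ℂ → ℂ} {s : ℂ}
    (hs : s ∈ Metric.ball (0 : ℂ) 1) (hτs : τ s ∈ Metric.ball (0 : ℂ) 1) (h0 : s ≠ 0 ∨ τ s ≠ 0)
    (hτ : ContinuousAt τ s) (h : ∀ᶠ t in 𝓝 s, D.param j (τ t) = C.param i t) :
    DifferentiableAt ℂ τ s := by
  have hb : 0 < localOrder g q.1.2 / (localOrder f q.1.1).gcd (localOrder g q.1.2) :=
    Nat.div_pos (Nat.gcd_le_right _ D.order_snd_pos) (Nat.gcd_pos_of_pos_right _ D.order_snd_pos)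
  have hmem : (C.param i s).1.1 ∈ D.fst.source := by
    rw [← h.self_of_nhds]
    exact (D.param_mem_domain hτs).1
  refine differentiableAt_of_pow (g := fun t => D.fst (C.param i t).1.1) hb hτ ?_ ?_ ?_
  · by_cases h1 : τ s = 0
    · right
      have h2 := h.self_of_nhds
      rw [h1, D.param_zero] at h2
      have h3 := C.localOrder_param (i := i) hf hg hs (h0.resolve_right (not_not.2 h1))
      rw [← h2] at h3
      rw [h3.1, h3.2]
      rfl
    · exact Or.inl h1
  · have h1 : MDifferentiableAt 𝓘(ℂ) 𝓘(ℂ) D.fst (C.param i s).1.1 :=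
      D.fst_mdifferentiable.1.mdifferentiableAt (D.fst.open_source.mem_nhds hmem)
    have h2 : MDifferentiableAt 𝓘(ℂ) 𝓘(ℂ) (fun t => (C.param i t).1.1) s :=
      (C.mdifferentiableOn_param_fst i).mdifferentiableAt (Metric.isOpen_ball.mem_nhds hs)
    exact (h1.comp s h2).differentiableAt
  · filter_upwards [h, hτ.preimage_mem_nhds (Metric.isOpen_ball.mem_nhds hτs)] with t ht ht'
    rw [← ht]
    exact (congrArg Prod.fst (D.coord_param (i := j) ht')).symm

/-- The branched atlas of a fiber product of holomorphic maps. -/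
noncomputable def fiberProductAtlas [IsManifold 𝓘(ℂ) ω X] [IsManifold 𝓘(ℂ) ω Y]
    [IsManifold 𝓘(ℂ) ω Z] {f : X → Z} {g : Y → Z} (hf : IsHolomorphicMap f)
    (hg : IsHolomorphicMap g) (C : ∀ p : Function.Pullback f g, FiberChart f g p) :
    BranchedAtlas (Function.Pullback f g) where
  mult p := (localOrder f p.1.1).gcd (localOrder g p.1.2)
  mult_pos p := Nat.gcd_pos_of_pos_left _ (C p).order_fst_pos
  param p := (C p).param
  param_zero p := (C p).param_zero
  continuousOn_param p := (C p).continuousOn_param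
  param_injective p _ _ _ _ hs ht := (C p).param_injective hs ht
  mult_param p i t ht h0 := by
    rw [((C p).localOrder_param hf hg ht h0).1, Nat.gcd_one_left]
  isOpen_iUnion_image p _ hO hb h0 := (C p).isOpen_iUnion_image_param hO hb h0
  differentiableAt_change p _ q _ _ _ hs hτs h0 hτ h :=
    differentiableAt_param_change hf hg (C p) (C q) hs hτs h0 hτ h

/-- Finitely many coordinate domains cover, and each contains no singular point other than possibly
its center. -/
theorem finite_fiberProductSingularPoints [IsManifold 𝓘(ℂ) ω X] [IsManifold 𝓘(ℂ) ω Y]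
    [IsManifold 𝓘(ℂ) ω Z] {f : X → Z} {g : Y → Z} [CompactSpace (Function.Pullback f g)]
    (hf : IsHolomorphicMap f) (hg : IsHolomorphicMap g)
    (C : ∀ p : Function.Pullback f g, FiberChart f g p) :
    (fiberProductSingularPoints f g).Finite := by
  obtain ⟨s, hs⟩ := isCompact_univ.elim_finite_subcover (fun p => (C p).domain)
    (fun p => (C p).isOpen_domain) fun p _ => mem_iUnion.2 ⟨p, (C p).mem_domain⟩
  refine s.finite_toSet.subset fun q hq => ?_
  obtain ⟨p, hp, hqp⟩ := mem_iUnion₂.1 (hs (mem_univ q))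
  obtain ⟨i, t, ht, rfl⟩ := (C p).exists_param_eq hqp
  by_cases h0 : t = 0
  · rw [h0, (C p).param_zero]
    exact hp
  · have h1 := ((C p).localOrder_param (i := i) hf hg ht h0).1
    have h2 := hq.1
    omega

end fiberProduct

/-! ### Assembly of the theorem. -/

theorem proposition2p1 (S₀ : ClosedRiemannSurface.{u})
    (S₁ : ClosedRiemannSurface.{v}) (S₂ : ClosedRiemannSurface.{w})
    (β₁ : S₁ → S₀) (β₂ : S₂ → S₀)
    (hβ₁ : IsHolomorphicMap β₁) (hβ₂ : IsHolomorphicMap β₂)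
    (hc₁ : ¬ ∃ c, ∀ z, β₁ z = c) (hc₂ : ¬ ∃ c, ∀ z, β₂ z = c) :
    -- the fiber product is a singular Riemann surface, whose complex structure is the one for
    -- which both projections are holomorphic
    (∃ (X : SingularRiemannSurface.{max v w}) (Φ : X.Space ≃ₜ Function.Pullback β₁ β₂),
      (∀ i, IsHolomorphicMap fun x : X.component i => (Φ (X.glue ⟨i, x⟩)).1.1) ∧
      (∀ i, IsHolomorphicMap fun x : X.component i => (Φ (X.glue ⟨i, x⟩)).1.2) ∧
      -- the singularities correspond to the singular points of the fiber product
      Φ '' X.singularities = fiberProductSingularPoints β₁ β₂ ∧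
      -- exactly `gcd (n₁, n₂)` points of the components are glued to a point
      ∀ p : Function.Pullback β₁ β₂,
        {x | Φ (X.glue x) = p}.ncard =
          Nat.gcd (localOrder β₁ p.1.1) (localOrder β₂ p.1.2)) ∧
    -- the local picture: `gcd (n₁, n₂)` cones with a common vertex
    (∀ p : Function.Pullback β₁ β₂,
      0 < localOrder β₁ p.1.1 ∧ 0 < localOrder β₂ p.1.2 ∧
      ∃ (U : Set (Function.Pullback β₁ β₂)) (hp : p ∈ U), IsOpen U ∧
        ∃ h : U ≃ₜ ConeBouquet (Nat.gcd (localOrder β₁ p.1.1) (localOrder β₂ p.1.2)),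
          (h ⟨p, hp⟩).IsVertex) := by
  have C : ∀ p : Function.Pullback β₁ β₂, FiberChart β₁ β₂ p := fun p =>
    (nonempty_fiberChart hβ₁ hβ₂ p (hβ₁.not_eventually_const hc₁ _)
      (hβ₂.not_eventually_const hc₂ _)).some
  refine ⟨?_, fun p => ⟨(C p).order_fst_pos, (C p).order_snd_pos, (C p).domain, (C p).mem_domain,
    (C p).isOpen_domain, (C p).exists_homeomorph_coneBouquet⟩⟩
  have hcont₁ : Continuous β₁ := MDifferentiable.continuous hβ₁
  have hcont₂ : Continuous β₂ := MDifferentiable.continuous hβ₂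
  have : CompactSpace (Function.Pullback β₁ β₂) := isCompact_iff_compactSpace.1
    (isClosed_eq (hcont₁.comp continuous_fst) (hcont₂.comp continuous_snd)).isCompact
  have hne : Nonempty (Function.Pullback β₁ β₂) := by
    obtain ⟨y⟩ : Nonempty S₂ := inferInstance
    obtain ⟨x, hx⟩ := hβ₁.surjective hc₁ (β₂ y)
    exact ⟨⟨(x, y), hx⟩⟩
  let A := fiberProductAtlas hβ₁ hβ₂ C
  have : Nonempty A.Normalization := hne.elim fun p => ⟨(A.surjective_point p).choose⟩
  -- The glued fibers lie over the singular points, including those with coprime orders, whose fiber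
  -- is a singleton. At any other point one order is one, so the gcd is one and nothing needs
  -- gluing.
  obtain ⟨X, Φ, κ, hκ, hΦ, hS⟩ := exists_singularRiemannSurface (R := A.Normalization)
    A.continuous_point A.surjective_point (finite_fiberProductSingularPoints hβ₁ hβ₂ C)
    (fun p _ => Set.finite_of_ncard_pos (by rw [A.ncard_fiber]; exact A.mult_pos p))
    (fun x y hxy hx => BranchedAtlas.Normalization.ext_of_mult_eq_one hxy (by
      have h1 := (C x.point).order_fst_pos
      have h2 := (C x.point).order_snd_pos
      simp only [fiberProductSingularPoints, mem_ofPred_eq, not_and_or, not_le] at hx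
      change Nat.gcd _ _ = 1
      rcases hx with hx | hx
      · rw [show localOrder β₁ x.point.1.1 = 1 by omega, Nat.gcd_one_left]
      · rw [show localOrder β₂ x.point.1.2 = 1 by omega, Nat.gcd_one_right]))
  refine ⟨X, Φ, fun i => ?_, fun i => ?_, hS, fun p => ?_⟩
  · simp only [hΦ]
    exact (A.isHolomorphicMap_comp_point (g := fun q => q.1.1)
      fun p j => (C p).mdifferentiableOn_param_fst j).comp (hκ i)
  · simp only [hΦ]
    exact (A.isHolomorphicMap_comp_point (g := fun q => q.1.2)
      fun p j => (C p).mdifferentiableOn_param_snd j).comp (hκ i)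
  · simp only [hΦ]
    have e : {x | (κ x).point = p} = κ ⁻¹' {x | x.point = p} := rfl
    rw [e, ncard_preimage_of_injective_subset_range κ.injective (by simp [κ.surjective.range_eq]),
      A.ncard_fiber]
    rfl
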